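/- **Spaces.** Let $\mathcal D$ be the set of pairs $f=\{f^-,f^+\}$, where $f^+:\mathbb R\to\mathbb R$ is non-decreasing, right-continuous, satisfies $f^+(x+n)=f^+(x)+n$ for $x\in\mathbb R$, $n\in\mathbb Z$, and $f^-(x)=\lim_{y\uparrow x}f^+(y)$. For $f\in\mathcal D$ and $t\in\mathbb R$ let $f^\times(t)=t-x$, where $x$ is the unique point with $\frac{x+f^-(x)}2\le t\le\frac{x+f^+(x)}2$; this is a function of period $1$. Put $d_{\mathcal D}(f,g)=\|f^\times-g^\times\|$, where $\|h\|=\sup_{t\in[0,1)}|h(t)|$; convergence in $\mathcal D$ is with respect to $d_{\mathcal D}$. $C^\circ(\mathbb R,\mathcal D)$ is the set of continuous weak flows, i.e. families $\phi=(\phi_{ts}:s<t)$ in $\mathcal D$ with $\phi_{ut}^-\circ\phi_{ts}^-\le\phi_{us}^-\le\phi_{us}^+\le\phi_{ut}^+\circ\phi_{ts}^+$ for $s<t<u$, and $\phi_{ts}\to\mathrm{id}$ as $s\uparrow t$, $\phi_{ut}\to\mathrm{id}$ as $u\downarrow t$, for all $t$. It carries the metric $d_C(\phi,\psi)=\sum_{n\ge1}2^{-n}\bigl(1\wedge\sup_{-n<s<t<n}d_{\mathcal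 D}(\phi_{ts},\psi_{ts})\bigr)$. $D^\circ(\mathbb R,\mathcal D)$ is the set of cadlag weak flows, i.e. families $\phi=(\phi_I)$ in $\mathcal D$, indexed by the non-empty bounded intervals $I\subseteq\mathbb R$ of all types, with $\phi_{I_2}^-\circ\phi_{I_1}^-\le\phi_I^-\le\phi_I^+\le\phi_{I_2}^+\circ\phi_{I_1}^+$ whenever $I$ is the disjoint union of intervals $I_1,I_2$ with $I_1$ to the left of $I_2$, and $\phi_{(s,t)}\to\mathrm{id}$ as $s\uparrow t$, $\phi_{(t,u)}\to\mathrm{id}$ as $u\downarrow t$, for all $t$. Put $\phi_\emptyset=\mathrm{id}$. It carries the metric $d_D=\sum_{n\ge1}2^{-n}(d_D^{(n)}\wedge1)$, where $$d_D^{(n)}(\phi,\psi)=\inf_\lambda\Bigl\{\gamma(\lambda)\vee\sup_I\|\chi_n(I)\phi_I^\times-\chi_n(\lambda(I))\psi_{\lambda(I)}^\times\|\Bigr\},$$ the infimum is over increasing homeomorphisms $\lambda$ of $\mathbb R$, $\gamma(\lambda)=\sup_t|\lambda(t)-t|\vee\sup_{s<t}\bigl|\log\frac{\lambda(t)-\lambda(s)}{t-s}\bigr|$,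 and $\chi_n(I)=0\vee(n+1-R)\wedge1$ with $R=\sup I\vee(-\inf I)$. We regard $C^\circ(\mathbb R,\mathcal D)$ as a subset of $D^\circ(\mathbb R,\mathcal D)$ by setting $\phi_I=\phi_{ts}$ for every bounded interval $I$ with end-points $s<t$, and $\phi_{\{t\}}=\mathrm{id}$. For $e=(s,x)\in\mathbb R^2$ let $D_e$ be the space of cadlag paths $[s,\infty)\to\mathbb R$ starting from $x$ at time $s$, with the Skorokhod ($J_1$) topology. For a sequence $E=(e_k)$ in $\mathbb R^2$ let $D_E=\prod_kD_{e_k}$, with the product topology. For $\phi\in D^\circ(\mathbb R,\mathcal D)$ put $Z^{e,\pm}(\phi)=(\phi_{(s,t]}^\pm(x):t\ge s)\in D_e$, $Z^{E,\pm}(\phi)=(Z^{e_k,\pm}(\phi))_k\in D_E$, and $Z^E=Z^{E,+}$. **Theorem.** Let $E=(e_k:k\in\mathbb N)$ be an enumeration of $\mathbb Q^2$. Then $Z^E:D^\circ(\mathbb R,\mathcal D)\to D_E$ is Borel measurable and the following holds. Let $(\mu_n)_{n\in\mathbb N}$ be a sequence of Borel probability measures on $D^\circ(\mathbb R,\mathcal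 D)$ and let $\mu$ be a Borel probability measure on $C^\circ(\mathbb R,\mathcal D)$. Assume that $Z^{E,-}=Z^{E,+}$ holds $\mu_n$-almost surely for every $n$, and $\mu$-almost surely, and that $\mu_n\circ(Z^E)^{-1}\to\mu\circ(Z^E)^{-1}$ weakly on $D_E$. Then $\mu_n\to\mu$ weakly on $D^\circ(\mathbb R,\mathcal D)$. -/

import Mathlib

open Set Filter Topology MeasureTheory
open scoped ENNReal

namespace WeakFlow

/-! Non-decreasing maps of degree one -/

/-- An element `f = {f⁻, f⁺}` of the space `𝒟`: it is recorded by its right-continuous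
version `f⁺`, a non-decreasing right-continuous function with `f⁺ (x + n) = f⁺ x + n`;
the left-continuous version `f⁻` is `DegreeOne.left`. -/
@[ext]
structure DegreeOne where
  right : ℝ → ℝ
  monotone_right : Monotone right
  right_continuous : ∀ x, ContinuousWithinAt right (Ici x) x
  degree_one : ∀ (x : ℝ) (n : ℤ), right (x + n) = right x + n

namespace DegreeOne

/-- The left-continuous modification `f⁻ x = lim_{y ↑ x} f⁺ y`. -/
noncomputable def left (f : DegreeOne) : ℝ → ℝ := Function.leftLim f.right

/-- The identity map. -/
def ident : DegreeOne where
  right := fun x => x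
  monotone_right := monotone_id
  right_continuous := fun _ => continuousWithinAt_id
  degree_one := fun _ _ => rfl

theorem left_le_right (f : DegreeOne) (x : ℝ) : f.left x ≤ f.right x :=
  f.monotone_right.leftLim_le le_rfl

theorem right_le_left (f : DegreeOne) {x y : ℝ} (h : x < y) : f.right x ≤ f.left y :=
  f.monotone_right.le_leftLim h

theorem tendsto_left (f : DegreeOne) (x : ℝ) :
    Tendsto f.right (𝓝[<] x) (𝓝 (f.left x)) :=
  f.monotone_right.tendsto_leftLim x

theorem left_ident (x : ℝ) : ident.left x = x :=
  tendsto_nhds_unique (ident.tendsto_left x)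
    (tendsto_id.mono_left nhdsWithin_le_nhds)

theorem le_right_of_forall_gt (f : DegreeOne) {x c : ℝ} (h : ∀ y, x < y → c ≤ f.right y) :
    c ≤ f.right x := by
  have h1 : Tendsto f.right (𝓝[>] x) (𝓝 (f.right x)) :=
    (f.right_continuous x).mono Ioi_subset_Ici_self
  exact ge_of_tendsto h1 (eventually_nhdsWithin_of_forall h)

theorem left_le_of_forall_lt (f : DegreeOne) {x c : ℝ} (h : ∀ y, y < x → f.right y ≤ c) :
    f.left x ≤ c :=
  le_of_tendsto (f.tendsto_left x) (eventually_nhdsWithin_of_forall h)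

/-- For each `t` there is exactly one `x` such that the graph of `f`, with its jumps filled in
by vertical segments, meets the line `{(x, y) : x + y = 2 t}` above `x`. -/
theorem existsUnique_cross (f : DegreeOne) (t : ℝ) :
    ∃! x : ℝ, (x + f.left x) / 2 ≤ t ∧ t ≤ (x + f.right x) / 2 := by
  have hper : ∀ n : ℤ, f.right n = f.right 0 + n := fun n => by
    simpa using f.degree_one 0 n
  set S : Set ℝ := {x | 2 * t ≤ x + f.right x} with hS
  have hne : S.Nonempty := by
    obtain ⟨n, hn⟩ := exists_int_gt (|2 * t| + |f.right 0|)
    refine ⟨n, ?_⟩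
    have h0 : (0 : ℝ) ≤ n := le_trans (by positivity) hn.le
    simp only [hS, mem_ofPred_eq, hper]
    linarith [le_abs_self (2 * t), neg_abs_le (f.right 0)]
  have hbdd : BddBelow S := by
    obtain ⟨n, hn⟩ := exists_int_lt (-(|2 * t| + |f.right 0|))
    refine ⟨n, fun x hx => ?_⟩
    by_contra hlt
    push Not at hlt
    have h1 := f.monotone_right hlt.le
    rw [hper] at h1
    simp only [hS, mem_ofPred_eq] at hx
    have h0 : (0 : ℝ) ≤ |2 * t| + |f.right 0| := by positivity
    linarith [neg_abs_le (2 * t), le_abs_self (f.right 0)]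
  have hup : ∀ y, sInf S < y → 2 * t ≤ y + f.right y := by
    intro y hy
    obtain ⟨z, hz, hzy⟩ := exists_lt_of_csInf_lt hne hy
    have h1 := f.monotone_right hzy.le
    simp only [hS, mem_ofPred_eq] at hz
    linarith
  have hlow : ∀ y, y < sInf S → y + f.right y < 2 * t := by
    intro y hy
    by_contra hc
    push Not at hc
    exact absurd (csInf_le hbdd (show y ∈ S from hc)) (not_le.mpr hy)
  refine ⟨sInf S, ⟨?_, ?_⟩, ?_⟩
  · have h1 : Tendsto (fun y => y + f.right y) (𝓝[<] (sInf S))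
        (𝓝 (sInf S + f.left (sInf S))) :=
      (tendsto_id.mono_left nhdsWithin_le_nhds).add (f.tendsto_left _)
    have h2 := le_of_tendsto h1 (eventually_nhdsWithin_of_forall fun y hy => (hlow y hy).le)
    linarith
  · have h1 : Tendsto (fun y => y + f.right y) (𝓝[>] (sInf S))
        (𝓝 (sInf S + f.right (sInf S))) :=
      (tendsto_id.mono_left nhdsWithin_le_nhds).add
        ((f.right_continuous _).mono Ioi_subset_Ici_self)
    have h2 := ge_of_tendsto h1 (eventually_nhdsWithin_of_forall fun y hy => hup y hy)
    linarith
  · rintro y ⟨hy1, hy2⟩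
    rcases lt_trichotomy y (sInf S) with h | h | h
    · linarith [hlow y h]
    · exact h
    · obtain ⟨z, hz1, hz2⟩ := exists_between h
      linarith [hup z hz1, f.right_le_left hz2]

/-- The function `f^×`: `f^× t = t - x` where `x` is the unique point with
`(x + f⁻ x) / 2 ≤ t ≤ (x + f⁺ x) / 2`. -/
noncomputable def cross (f : DegreeOne) (t : ℝ) : ℝ :=
  t - (f.existsUnique_cross t).choose

theorem cross_eq (f : DegreeOne) {t x : ℝ} (h1 : (x + f.left x) / 2 ≤ t)
    (h2 : t ≤ (x + f.right x) / 2) : f.cross t = t - x := by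
  have h := (f.existsUnique_cross t).choose_spec.2 x ⟨h1, h2⟩
  rw [cross, ← h]

theorem cross_spec (f : DegreeOne) (t : ℝ) :
    (t - f.cross t + f.left (t - f.cross t)) / 2 ≤ t ∧
      t ≤ (t - f.cross t + f.right (t - f.cross t)) / 2 := by
  have h := (f.existsUnique_cross t).choose_spec.1
  simpa only [cross, sub_sub_cancel] using h

theorem cross_ident (t : ℝ) : ident.cross t = 0 := by
  have h : ident.cross t = t - t := ident.cross_eq (by rw [left_ident]; linarith)
    (by simp [ident])
  simpa using h

theorem left_add_int (f : DegreeOne) (x : ℝ) (n : ℤ) : f.left (x + n) = f.left x + n := by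
  have h1 : Tendsto (fun y : ℝ => y + n) (𝓝[<] x) (𝓝[<] (x + n)) := by
    refine tendsto_nhdsWithin_iff.mpr ⟨?_, ?_⟩
    · exact ((continuous_id.add continuous_const).tendsto x).mono_left nhdsWithin_le_nhds
    · exact eventually_nhdsWithin_of_forall fun y (hy : y < x) => by
        simpa using hy
  have h2 := (f.tendsto_left (x + n)).comp h1
  have h3 : f.right ∘ (fun y : ℝ => y + n) = fun y => f.right y + n := by
    funext y; exact f.degree_one y n
  rw [h3] at h2
  exact tendsto_nhds_unique h2 ((f.tendsto_left x).add_const _)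

theorem cross_add_int (f : DegreeOne) (t : ℝ) (n : ℤ) : f.cross (t + n) = f.cross t := by
  obtain ⟨h1, h2⟩ := f.cross_spec t
  have h := f.cross_eq (t := t + n) (x := t - f.cross t + n)
    (by rw [left_add_int]; linarith) (by rw [degree_one]; linarith)
  rw [h]; ring

end DegreeOne

/-- The uniform norm `sup_{t ∈ [0,1)} |h t|` of a function of period one. -/
noncomputable def circleNorm (h : ℝ → ℝ) : ℝ≥0∞ := ⨆ t ∈ Ico (0 : ℝ) 1, ‖h t‖ₑ

theorem circleNorm_zero : circleNorm (fun _ => 0) = 0 := by simp [circleNorm]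

theorem circleNorm_sub_comm (f g : ℝ → ℝ) :
    circleNorm (fun t => f t - g t) = circleNorm (fun t => g t - f t) := by
  unfold circleNorm
  simp only [← edist_eq_enorm_sub, edist_comm]

theorem circleNorm_sub_le (f g h : ℝ → ℝ) :
    circleNorm (fun t => f t - h t) ≤
      circleNorm (fun t => f t - g t) + circleNorm (fun t => g t - h t) := by
  unfold circleNorm
  simp only [← edist_eq_enorm_sub]
  refine iSup₂_le fun t ht => (edist_triangle _ (g t) _).trans (add_le_add ?_ ?_)
  · exact le_iSup₂ (f := fun t (_ : t ∈ Ico (0 : ℝ) 1) => edist (f t) (g t)) t ht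
  · exact le_iSup₂ (f := fun t (_ : t ∈ Ico (0 : ℝ) 1) => edist (g t) (h t)) t ht

/-- The metric `d_𝒟 (f, g) = ‖f^× - g^×‖`. -/
noncomputable instance : PseudoEMetricSpace DegreeOne where
  edist f g := circleNorm (fun t => f.cross t - g.cross t)
  edist_self f := by simpa using circleNorm_zero
  edist_comm f g := circleNorm_sub_comm _ _
  edist_triangle f g h := circleNorm_sub_le _ _ _

theorem DegreeOne.edist_def (f g : DegreeOne) :
    edist f g = circleNorm (fun t => f.cross t - g.cross t) := rfl

namespace DegreeOne

theorem enorm_cross_le (f : DegreeOne) (t : ℝ) : ‖f.cross t‖ₑ ≤ edist f ident := by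
  have h1 : f.cross t = f.cross (Int.fract t) := by
    rw [← f.cross_add_int (Int.fract t) ⌊t⌋, Int.fract_add_floor]
  rw [h1, edist_def]
  simp only [cross_ident, sub_zero]
  exact le_iSup₂ (f := fun t (_ : t ∈ Ico (0 : ℝ) 1) => ‖f.cross t‖ₑ) (Int.fract t)
    ⟨Int.fract_nonneg t, Int.fract_lt_one t⟩

theorem abs_sub_le_of_edist_lt {f : DegreeOne} {ε : ℝ}
    (h : edist f ident < ENNReal.ofReal ε) (x : ℝ) :
    |f.right x - x| ≤ 2 * ε ∧ |f.left x - x| ≤ 2 * ε := by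
  have hε : 0 < ε := by
    by_contra hc
    rw [ENNReal.ofReal_of_nonpos (not_lt.mp hc)] at h
    exact absurd h not_lt_zero
  have key : ∀ t, |f.cross t| ≤ ε := fun t => by
    have h1 := (f.enorm_cross_le t).trans h.le
    rw [Real.enorm_eq_ofReal_abs] at h1
    exact (ENNReal.ofReal_le_ofReal_iff hε.le).mp h1
  have hlr := f.left_le_right x
  constructor
  · have h1 := key ((x + f.right x) / 2)
    rw [f.cross_eq (x := x) (by linarith) le_rfl, abs_le] at h1
    rw [abs_le]; constructor <;> linarith [h1.1, h1.2]
  · have h1 := key ((x + f.left x) / 2)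
    rw [f.cross_eq (x := x) le_rfl (by linarith), abs_le] at h1
    rw [abs_le]; constructor <;> linarith [h1.1, h1.2]

/-- `h` lies between the compositions `g⁻ ∘ f⁻` and `g⁺ ∘ f⁺`:
`g⁻ ∘ f⁻ ≤ h⁻ ≤ h⁺ ≤ g⁺ ∘ f⁺`. -/
def WeakComp (g f h : DegreeOne) : Prop :=
  ∀ x, g.left (f.left x) ≤ h.left x ∧ h.left x ≤ h.right x ∧ h.right x ≤ g.right (f.right x)

theorem weakComp_ident_left (f : DegreeOne) : WeakComp ident f f := fun x =>
  ⟨(left_ident _).le, f.left_le_right x, le_rfl⟩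

theorem weakComp_ident_right (f : DegreeOne) : WeakComp f ident f := fun x =>
  ⟨by rw [left_ident], f.left_le_right x, le_rfl⟩

/-- If `g` is uniformly `ε`-close to the identity, then `h` is uniformly `ε`-close to `f`. -/
theorem WeakComp.close {g f h : DegreeOne} (H : WeakComp g f h) {ε : ℝ}
    (hr : ∀ x, |g.right x - x| ≤ ε) (hl : ∀ x, |g.left x - x| ≤ ε) (x : ℝ) :
    |h.right x - f.right x| ≤ ε ∧ |h.left x - f.left x| ≤ ε := by
  have hr' := fun x => abs_le.mp (hr x)
  have hl' := fun x => abs_le.mp (hl x)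
  have h1 : h.right x ≤ f.right x + ε := by
    linarith [(H x).2.2, (hr' (f.right x)).2]
  have h2 : f.left x - ε ≤ h.left x := by
    linarith [(H x).1, (hl' (f.left x)).1]
  have h3 : f.right x - ε ≤ h.right x := h.le_right_of_forall_gt fun y hy => by
    linarith [(H y).1, (hl' (f.left y)).1, f.right_le_left hy, h.left_le_right y]
  have h4 : h.left x ≤ f.left x + ε := h.left_le_of_forall_lt fun y hy => by
    linarith [(H y).2.2, (hr' (f.right y)).2, f.right_le_left hy]
  exact ⟨abs_le.mpr ⟨by linarith, by linarith⟩, abs_le.mpr ⟨by linarith, by linarith⟩⟩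

end DegreeOne

/-! Metrics of the form `∑_{n ≥ 1} 2^{-n} (d_n ∧ 1)` -/

/-- The weighted sum `∑_{n ≥ 1} 2^{-n} (d n ∧ 1)`. -/
noncomputable def weightedSum (d : ℕ → ℝ≥0∞) : ℝ≥0∞ :=
  ∑' n : ℕ, (2⁻¹ : ℝ≥0∞) ^ (n + 1) * min (d (n + 1)) 1

/-- The (pseudo)metric `∑_{n ≥ 1} 2^{-n} (d n ∧ 1)` built from a sequence of (pseudo)metrics. -/
noncomputable abbrev weightedEMetric {α : Type*} (d : ℕ → α → α → ℝ≥0∞)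
    (hself : ∀ n x, d n x x = 0) (hcomm : ∀ n x y, d n x y = d n y x)
    (htri : ∀ n x y z, d n x z ≤ d n x y + d n y z) : PseudoEMetricSpace α where
  edist x y := weightedSum (fun n => d n x y)
  edist_self x := by simp [weightedSum, hself]
  edist_comm x y := by simp [hcomm _ x y]
  edist_triangle x y z := by
    unfold weightedSum
    rw [← ENNReal.tsum_add]
    refine ENNReal.tsum_le_tsum fun n => ?_
    rw [← mul_add]
    refine mul_le_mul_right ?_ _
    rcases le_total (d (n + 1) x y) 1 with h1 | h1
    · rcases le_total (d (n + 1) y z) 1 with h2 | h2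
      · rw [min_eq_left h1, min_eq_left h2]
        exact (min_le_left _ _).trans (htri _ _ _ _)
      · rw [min_eq_right h2]
        exact (min_le_right _ _).trans le_add_self
    · rw [min_eq_right h1]
      exact (min_le_right _ _).trans le_self_add

/-! Continuous weak flows -/

/-- The space `C°(ℝ, 𝒟)` of continuous weak flows `φ = (φ_{ts} : s < t)`; here `φ s t` stands
for `φ_{ts}`. The values for `t ≤ s` carry no information and are set to the identity. -/
structure ContFlow where
  toFun : ℝ → ℝ → DegreeOne
  map_of_le : ∀ s t, t ≤ s → toFun s t = DegreeOne.ident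
  weak_flow : ∀ s t u, s < t → t < u →
    DegreeOne.WeakComp (toFun t u) (toFun s t) (toFun s u)
  tendsto_left : ∀ t, Tendsto (fun s => toFun s t) (𝓝[<] t) (𝓝 DegreeOne.ident)
  tendsto_right : ∀ t, Tendsto (fun u => toFun t u) (𝓝[>] t) (𝓝 DegreeOne.ident)

/-- `d_C^{(n)} (φ, ψ) = sup {d_𝒟 (φ_{ts}, ψ_{ts}) : s, t ∈ (-n, n), s < t}`. -/
noncomputable def contDist (n : ℕ) (φ ψ : ContFlow) : ℝ≥0∞ :=
  ⨆ (s : ℝ) (t : ℝ) (_ : -(n : ℝ) < s ∧ s < t ∧ t < n), edist (φ.toFun s t) (ψ.toFun s t)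

theorem le_contDist (n : ℕ) (φ ψ : ContFlow) {s t : ℝ} (h : -(n : ℝ) < s ∧ s < t ∧ t < n) :
    edist (φ.toFun s t) (ψ.toFun s t) ≤ contDist n φ ψ :=
  le_iSup_of_le s (le_iSup_of_le t (le_iSup_of_le h le_rfl))

/-- The metric `d_C = ∑_{n ≥ 1} 2^{-n} (d_C^{(n)} ∧ 1)`. -/
noncomputable instance : PseudoEMetricSpace ContFlow :=
  weightedEMetric contDist
    (fun _ φ => by simp [contDist])
    (fun _ φ ψ => by simp only [contDist, edist_comm])
    (fun n φ ψ χ => iSup_le fun s => iSup_le fun t => iSup_le fun h =>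
      (edist_triangle _ (ψ.toFun s t) _).trans
        (add_le_add (le_contDist n φ ψ h) (le_contDist n ψ χ h)))

noncomputable instance : MeasurableSpace ContFlow := borel ContFlow

instance : BorelSpace ContFlow := ⟨rfl⟩

/-! Cadlag weak flows -/

/-- Bounded intervals of `ℝ`, of all types (open, closed, half-open, one-point); the empty
interval is included. -/
@[ext]
structure BInterval where
  carrier : Set ℝ
  ordConnected : carrier.OrdConnected
  bddBelow : BddBelow carrier
  bddAbove : BddAbove carrier

namespace BInterval

/-- The empty interval. -/
def empty : BInterval := ⟨∅, ordConnected_empty, bddBelow_empty, bddAbove_empty⟩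

/-- The interval `(s, t)`. -/
def ioo (s t : ℝ) : BInterval := ⟨Ioo s t, ordConnected_Ioo, bddBelow_Ioo, bddAbove_Ioo⟩

/-- The interval `(s, t]`. -/
def ioc (s t : ℝ) : BInterval := ⟨Ioc s t, ordConnected_Ioc, bddBelow_Ioc, bddAbove_Ioc⟩

/-- The image of an interval under an increasing homeomorphism of `ℝ`. -/
def image (l : ℝ ≃o ℝ) (I : BInterval) : BInterval where
  carrier := l '' I.carrier
  ordConnected := by
    refine ⟨?_⟩
    rintro _ ⟨a, ha, rfl⟩ _ ⟨b, hb, rfl⟩ y ⟨h1, h2⟩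
    refine ⟨l.symm y, I.ordConnected.out ha hb ⟨?_, ?_⟩, l.apply_symm_apply y⟩
    · rwa [l.le_symm_apply]
    · rwa [l.symm_apply_le]
  bddBelow := l.monotone.map_bddBelow I.bddBelow
  bddAbove := l.monotone.map_bddAbove I.bddAbove

theorem image_refl (I : BInterval) : image (OrderIso.refl ℝ) I = I := by
  ext x; simp [image]

theorem image_trans (l m : ℝ ≃o ℝ) (I : BInterval) :
    image (l.trans m) I = image m (image l I) := by
  ext x; simp [image]

theorem image_symm_image (l : ℝ ≃o ℝ) (I : BInterval) : image l (image l.symm I) = I := by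
  rw [← image_trans, OrderIso.symm_trans_self, image_refl]

/-- `I = I₁ ⊕ I₂`: the interval `I` is the disjoint union of the intervals `I₁` and `I₂`,
with `I₁` to the left of `I₂`. -/
def IsSum (I I₁ I₂ : BInterval) : Prop :=
  I₁.carrier ∪ I₂.carrier = I.carrier ∧ ∀ a ∈ I₁.carrier, ∀ b ∈ I₂.carrier, a < b

theorem isSum_ioc_ioc {s t u : ℝ} (h1 : s ≤ t) (h2 : t ≤ u) :
    IsSum (ioc s u) (ioc s t) (ioc t u) :=
  ⟨Ioc_union_Ioc_eq_Ioc h1 h2, fun _ ha _ hb => lt_of_le_of_lt ha.2 hb.1⟩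

theorem isSum_ioc_ioo {s t u : ℝ} (h1 : s ≤ t) (h2 : t < u) :
    IsSum (ioo s u) (ioc s t) (ioo t u) :=
  ⟨Ioc_union_Ioo_eq_Ioo h1 h2, fun _ ha _ hb => lt_of_le_of_lt ha.2 hb.1⟩

/-- The cutoff `χ_n (I) = 0 ∨ (n + 1 - R) ∧ 1` with `R = sup I ∨ (- inf I)`. -/
noncomputable def cutoff (n : ℕ) (I : BInterval) : ℝ :=
  max 0 (min ((n : ℝ) + 1 - max (sSup I.carrier) (-sInf I.carrier)) 1)

end BInterval

/-- The space `D°(ℝ, 𝒟)` of cadlag weak flows `φ = (φ_I)`, where `I` ranges over the bounded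
intervals. The value at the empty interval carries no information and is set to the identity. -/
structure CadlagFlow where
  toFun : BInterval → DegreeOne
  map_empty : toFun BInterval.empty = DegreeOne.ident
  weak_flow : ∀ I I₁ I₂ : BInterval, BInterval.IsSum I I₁ I₂ →
    DegreeOne.WeakComp (toFun I₂) (toFun I₁) (toFun I)
  tendsto_left : ∀ t, Tendsto (fun s => toFun (BInterval.ioo s t)) (𝓝[<] t) (𝓝 DegreeOne.ident)
  tendsto_right : ∀ t, Tendsto (fun u => toFun (BInterval.ioo t u)) (𝓝[>] t) (𝓝 DegreeOne.ident)

/-- For an increasing homeomorphism `l` of `ℝ`,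
`γ (l) = sup_t |l t - t| ∨ sup_{s < t} |log ((l t - l s) / (t - s))|`. -/
noncomputable def distortion (l : ℝ ≃o ℝ) : ℝ≥0∞ :=
  (⨆ t : ℝ, ENNReal.ofReal |l t - t|) ⊔
    ⨆ (s : ℝ) (t : ℝ) (_ : s < t), ENNReal.ofReal |Real.log ((l t - l s) / (t - s))|

theorem abs_log_ratio_comm {a b : ℝ} :
    |Real.log (a / b)| = |Real.log (b / a)| := by
  rw [← inv_div, Real.log_inv, abs_neg]

theorem abs_log_ratio_le {a b c : ℝ} (ha : 0 < a) (hb : 0 < b) (hc : 0 < c) :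
    |Real.log (a / c)| ≤ |Real.log (b / c)| + |Real.log (a / b)| := by
  rw [Real.log_div ha.ne' hc.ne', Real.log_div hb.ne' hc.ne', Real.log_div ha.ne' hb.ne']
  refine le_trans (le_of_eq ?_) (abs_add_le _ _)
  congr 1; ring

theorem distortion_refl : distortion (OrderIso.refl ℝ) = 0 := by
  have h : ∀ s t : ℝ, Real.log ((t - s) / (t - s)) = 0 := fun s t => by
    by_cases h : t - s = 0 <;> simp [h]
  simp [distortion, h]

theorem distortion_symm_le (l : ℝ ≃o ℝ) : distortion l.symm ≤ distortion l := by
  refine sup_le_sup (iSup_le fun t => le_iSup_of_le (l.symm t) ?_)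
    (iSup_le fun s => iSup_le fun t => iSup_le fun h =>
      le_iSup_of_le (l.symm s) (le_iSup_of_le (l.symm t)
        (le_iSup_of_le (l.symm.strictMono h) ?_)))
  · rw [l.apply_symm_apply, abs_sub_comm]
  · rw [l.apply_symm_apply, l.apply_symm_apply, abs_log_ratio_comm]

theorem distortion_trans_le (l m : ℝ ≃o ℝ) :
    distortion (l.trans m) ≤ distortion l + distortion m := by
  refine sup_le (iSup_le fun t => ?_) (iSup_le fun s => iSup_le fun t => iSup_le fun h => ?_)
  · refine le_trans ?_ (add_le_add
      (le_sup_of_le_left (le_iSup (fun t : ℝ => ENNReal.ofReal |l t - t|) t))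
      (le_sup_of_le_left (le_iSup (fun t : ℝ => ENNReal.ofReal |m t - t|) (l t))))
    rw [← ENNReal.ofReal_add (abs_nonneg _) (abs_nonneg _)]
    refine ENNReal.ofReal_le_ofReal ?_
    rw [OrderIso.trans_apply, add_comm]
    exact abs_sub_le _ _ _
  · have hl := l.strictMono h
    have hm := m.strictMono hl
    refine le_trans ?_ (add_le_add
      (le_sup_of_le_right (le_iSup_of_le s (le_iSup_of_le t (le_iSup_of_le h le_rfl))))
      (le_sup_of_le_right (le_iSup_of_le (l s) (le_iSup_of_le (l t) (le_iSup_of_le hl le_rfl)))))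
    rw [← ENNReal.ofReal_add (abs_nonneg _) (abs_nonneg _)]
    exact ENNReal.ofReal_le_ofReal
      (abs_log_ratio_le (sub_pos.mpr hm) (sub_pos.mpr hl) (sub_pos.mpr h))

/-- `sup_I ‖χ_n (I) φ_I^× - χ_n (l I) ψ_{l I}^×‖`, over all bounded intervals `I`. -/
noncomputable def warpedDist (n : ℕ) (φ ψ : CadlagFlow) (l : ℝ ≃o ℝ) : ℝ≥0∞ :=
  ⨆ I : BInterval, circleNorm (fun t =>
    I.cutoff n * (φ.toFun I).cross t - (I.image l).cutoff n * (ψ.toFun (I.image l)).cross t)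

/-- `d_D^{(n)} (φ, ψ)`, the infimum over all increasing homeomorphisms `l` of `ℝ` of
`γ (l) ∨ sup_I ‖χ_n (I) φ_I^× - χ_n (l I) ψ_{l I}^×‖`. -/
noncomputable def cadlagDist (n : ℕ) (φ ψ : CadlagFlow) : ℝ≥0∞ :=
  ⨅ l : ℝ ≃o ℝ, distortion l ⊔ warpedDist n φ ψ l

theorem warpedDist_refl_self (n : ℕ) (φ : CadlagFlow) :
    warpedDist n φ φ (OrderIso.refl ℝ) = 0 := by
  simp [warpedDist, BInterval.image_refl, circleNorm_zero]

theorem warpedDist_symm_le (n : ℕ) (φ ψ : CadlagFlow) (l : ℝ ≃o ℝ) :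
    warpedDist n ψ φ l.symm ≤ warpedDist n φ ψ l := by
  refine iSup_le fun I => le_iSup_of_le (I.image l.symm) ?_
  rw [BInterval.image_symm_image, circleNorm_sub_comm]

theorem warpedDist_trans_le (n : ℕ) (φ ψ χ : CadlagFlow) (l m : ℝ ≃o ℝ) :
    warpedDist n φ χ (l.trans m) ≤ warpedDist n φ ψ l + warpedDist n ψ χ m := by
  refine iSup_le fun I => ?_
  rw [BInterval.image_trans]
  exact (circleNorm_sub_le _ (fun t => (I.image l).cutoff n * (ψ.toFun (I.image l)).cross t) _).trans
    (add_le_add (le_iSup_of_le I le_rfl) (le_iSup_of_le (I.image l) le_rfl))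

theorem sup_le_add_sup {a b a₁ a₂ b₁ b₂ : ℝ≥0∞} (ha : a ≤ a₁ + a₂) (hb : b ≤ b₁ + b₂) :
    a ⊔ b ≤ (a₁ ⊔ b₁) + (a₂ ⊔ b₂) :=
  sup_le (ha.trans (add_le_add le_sup_left le_sup_left))
    (hb.trans (add_le_add le_sup_right le_sup_right))

theorem cadlagDist_comm_le (n : ℕ) (φ ψ : CadlagFlow) :
    cadlagDist n φ ψ ≤ cadlagDist n ψ φ :=
  le_iInf fun l => iInf_le_of_le l.symm
    (sup_le_sup (distortion_symm_le l) (warpedDist_symm_le n ψ φ l))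

/-- The Skorokhod-type metric `d_D = ∑_{n ≥ 1} 2^{-n} (d_D^{(n)} ∧ 1)`. -/
noncomputable instance : PseudoEMetricSpace CadlagFlow :=
  weightedEMetric cadlagDist
    (fun n φ => le_antisymm (iInf_le_of_le (OrderIso.refl ℝ) (by
      simp [distortion_refl, warpedDist_refl_self])) bot_le)
    (fun n φ ψ => le_antisymm (cadlagDist_comm_le n φ ψ) (cadlagDist_comm_le n ψ φ))
    (fun n φ ψ χ => by
      unfold cadlagDist
      refine ENNReal.le_iInf_add_iInf fun l m => ?_
      exact iInf_le_of_le (l.trans m)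
        (sup_le_add_sup (distortion_trans_le l m) (warpedDist_trans_le n φ ψ χ l m)))

noncomputable instance : MeasurableSpace CadlagFlow := borel CadlagFlow

instance : BorelSpace CadlagFlow := ⟨rfl⟩

/-! Continuous weak flows as cadlag weak flows -/

/-- A continuous weak flow `φ` regarded as a cadlag weak flow, by `φ_I = φ_{ts}` for every
bounded interval `I` with end-points `s < t` and `φ_{t} = id` for one-point intervals. -/
noncomputable def ContFlow.toCadlag (φ : ContFlow) : CadlagFlow where
  toFun I := φ.toFun (sInf I.carrier) (sSup I.carrier)
  map_empty := by simp [BInterval.empty, φ.map_of_le]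
  weak_flow := by
    rintro I I₁ I₂ ⟨hU, hlt⟩
    rcases I₁.carrier.eq_empty_or_nonempty with h1 | h1
    · rw [← hU, h1, empty_union]
      simp only [Real.sInf_empty, Real.sSup_empty, φ.map_of_le 0 0 le_rfl]
      exact DegreeOne.weakComp_ident_right _
    rcases I₂.carrier.eq_empty_or_nonempty with h2 | h2
    · rw [← hU, h2, union_empty]
      simp only [Real.sInf_empty, Real.sSup_empty, φ.map_of_le 0 0 le_rfl]
      exact DegreeOne.weakComp_ident_left _
    have hle : sSup I₁.carrier ≤ sInf I₂.carrier :=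
      csSup_le h1 fun a ha => le_csInf h2 fun b hb => (hlt a ha b hb).le
    have hle1 := csInf_le_csSup h1 I₁.bddBelow I₁.bddAbove
    have hle2 := csInf_le_csSup h2 I₂.bddBelow I₂.bddAbove
    have hinf : sInf I.carrier = sInf I₁.carrier := by
      rw [← hU, csInf_union I₁.bddBelow h1 I₂.bddBelow h2]
      exact min_eq_left (by linarith)
    have hsup : sSup I.carrier = sSup I₂.carrier := by
      rw [← hU, csSup_union I₁.bddAbove h1 I₂.bddAbove h2]
      exact max_eq_right (by linarith)
    have hmid : sSup I₁.carrier = sInf I₂.carrier := by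
      by_contra hne
      obtain ⟨c, hc1, hc2⟩ := exists_between (lt_of_le_of_ne hle hne)
      obtain ⟨a, ha⟩ := h1
      obtain ⟨b, hb⟩ := h2
      have haI : a ∈ I.carrier := hU ▸ Or.inl ha
      have hbI : b ∈ I.carrier := hU ▸ Or.inr hb
      have hcI : c ∈ I.carrier := I.ordConnected.out haI hbI
        ⟨(le_csSup I₁.bddAbove ha).trans hc1.le, hc2.le.trans (csInf_le I₂.bddBelow hb)⟩
      rw [← hU] at hcI
      rcases hcI with hc | hc
      · exact absurd (le_csSup I₁.bddAbove hc) (not_le.mpr hc1)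
      · exact absurd (csInf_le I₂.bddBelow hc) (not_le.mpr hc2)
    rw [hinf, hsup, hmid]
    rw [hmid] at hle1
    rcases hle1.eq_or_lt with h | h
    · rw [h, φ.map_of_le (sInf I₂.carrier) (sInf I₂.carrier) le_rfl]
      exact DegreeOne.weakComp_ident_right _
    rcases hle2.eq_or_lt with h' | h'
    · rw [← h', φ.map_of_le (sInf I₂.carrier) (sInf I₂.carrier) le_rfl]
      exact DegreeOne.weakComp_ident_left _
    exact φ.weak_flow _ _ _ h h'
  tendsto_left t := by
    refine (φ.tendsto_left t).congr' (eventually_nhdsWithin_of_forall fun s (hs : s < t) => ?_)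
    simp [BInterval.ioo, csInf_Ioo hs, csSup_Ioo hs]
  tendsto_right t := by
    refine (φ.tendsto_right t).congr' (eventually_nhdsWithin_of_forall fun s (hs : t < s) => ?_)
    simp [BInterval.ioo, csInf_Ioo hs, csSup_Ioo hs]

theorem cadlagDist_toCadlag_le (n : ℕ) (φ ψ : ContFlow) :
    cadlagDist n φ.toCadlag ψ.toCadlag ≤ contDist (n + 1) φ ψ := by
  refine iInf_le_of_le (OrderIso.refl ℝ) ?_
  rw [distortion_refl]
  refine sup_le bot_le (iSup_le fun I => ?_)
  rw [BInterval.image_refl]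
  have hc0 : 0 ≤ I.cutoff n := le_max_left _ _
  have hc1 : I.cutoff n ≤ 1 := max_le zero_le_one (min_le_right _ _)
  rcases hc0.eq_or_lt with h | h
  · simp [← h, circleNorm_zero]
  have hR : max (sSup I.carrier) (-sInf I.carrier) < n + 1 := by
    by_contra hc
    push Not at hc
    have h2 : min ((n : ℝ) + 1 - max (sSup I.carrier) (-sInf I.carrier)) 1 ≤ 0 :=
      (min_le_left _ _).trans (by linarith)
    exact absurd (max_eq_left h2) h.ne'
  obtain ⟨hR1, hR2⟩ := max_lt_iff.mp hR
  refine le_trans (b := edist (φ.toCadlag.toFun I) (ψ.toCadlag.toFun I)) ?_ ?_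
  · rw [DegreeOne.edist_def]
    refine iSup₂_mono fun t _ => ?_
    dsimp only
    rw [← mul_sub, Real.enorm_eq_ofReal_abs, Real.enorm_eq_ofReal_abs]
    refine ENNReal.ofReal_le_ofReal ?_
    rw [abs_mul, abs_of_nonneg hc0]
    exact mul_le_of_le_one_left (abs_nonneg _) hc1
  · change edist (φ.toFun (sInf I.carrier) (sSup I.carrier))
      (ψ.toFun (sInf I.carrier) (sSup I.carrier)) ≤ _
    rcases le_or_gt (sSup I.carrier) (sInf I.carrier) with hle | hlt
    · simp [φ.map_of_le _ _ hle, ψ.map_of_le _ _ hle]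
    · exact le_contDist _ _ _ ⟨by push_cast; linarith, hlt, by push_cast; linarith⟩

theorem ContFlow.continuous_toCadlag : Continuous ContFlow.toCadlag := by
  refine LipschitzWith.continuous (K := 2) fun φ ψ => ?_
  change weightedSum (fun n => cadlagDist n φ.toCadlag ψ.toCadlag) ≤
    2 * weightedSum (fun n => contDist n φ ψ)
  unfold weightedSum
  rw [← ENNReal.tsum_mul_left]
  refine le_trans (ENNReal.tsum_le_tsum fun n => ?_)
    (ENNReal.tsum_comp_le_tsum_of_injective (add_left_injective 1) _)
  rw [pow_succ' _ (n + 1), ← mul_assoc, ← mul_assoc,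
    ENNReal.mul_inv_cancel two_ne_zero ENNReal.ofNat_ne_top, one_mul]
  exact mul_le_mul_right (min_le_min_right _ (cadlagDist_toCadlag_le _ _ _)) _

/-! The Skorokhod spaces `D_e` and `D_E` -/

/-- The space `D_e = D_x([s, ∞), ℝ)`, `e = (s, x)`, of cadlag paths starting from `x` at
time `s`. -/
@[ext]
structure CadlagPath (e : ℝ × ℝ) where
  toFun : Ici e.1 → ℝ
  start : toFun ⟨e.1, self_mem_Ici⟩ = e.2
  right_continuous : ∀ t, ContinuousWithinAt toFun (Ici t) t
  left_limit : ∀ t, ∃ y, Tendsto toFun (𝓝[<] t) (𝓝 y)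

/-- For an increasing homeomorphism `l` of `[s, ∞)` (which necessarily fixes `s`),
`sup_{r < t} |log ((l t - l r) / (t - r))|`. -/
noncomputable def logSlope {s : ℝ} (l : Ici s ≃o Ici s) : ℝ≥0∞ :=
  ⨆ (r : Ici s) (t : Ici s) (_ : r < t),
    ENNReal.ofReal |Real.log (((l t : ℝ) - l r) / ((t : ℝ) - r))|

theorem logSlope_refl {s : ℝ} : logSlope (OrderIso.refl (Ici s)) = 0 := by
  have h : ∀ r t : ℝ, Real.log ((t - r) / (t - r)) = 0 := fun r t => by
    by_cases h : t - r = 0 <;> simp [h]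
  simp [logSlope, h]

theorem logSlope_symm_le {s : ℝ} (l : Ici s ≃o Ici s) : logSlope l.symm ≤ logSlope l := by
  refine iSup_le fun r => iSup_le fun t => iSup_le fun h =>
      le_iSup_of_le (l.symm r) (le_iSup_of_le (l.symm t)
        (le_iSup_of_le (l.symm.strictMono h) ?_))
  rw [l.apply_symm_apply, l.apply_symm_apply, abs_log_ratio_comm]

theorem logSlope_trans_le {s : ℝ} (l m : Ici s ≃o Ici s) :
    logSlope (l.trans m) ≤ logSlope l + logSlope m := by
  refine iSup_le fun r => iSup_le fun t => iSup_le fun h => ?_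
  have hl := l.strictMono h
  have hm := m.strictMono hl
  refine le_trans ?_ (add_le_add
    (le_iSup_of_le r (le_iSup_of_le t (le_iSup_of_le h le_rfl)))
    (le_iSup_of_le (l r) (le_iSup_of_le (l t) (le_iSup_of_le hl le_rfl))))
  rw [← ENNReal.ofReal_add (abs_nonneg _) (abs_nonneg _)]
  exact ENNReal.ofReal_le_ofReal
    (abs_log_ratio_le (sub_pos.mpr hm) (sub_pos.mpr hl) (sub_pos.mpr h))

/-- The time cutoff on `[s, ∞)`, equal to `1` up to time `s + n`, to `0` from time `s + n + 1`,
and affine in between. -/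
noncomputable def timeCutoff {s : ℝ} (n : ℕ) (t : Ici s) : ℝ :=
  max 0 (min ((n : ℝ) + 1 - (t - s)) 1)

/-- `‖(k_n z) ∘ l - k_n w‖`, the uniform distance of the time-changed path `z` to `w` after
the cutoff `k_n`. -/
noncomputable def pathWarpedDist {e : ℝ × ℝ} (n : ℕ) (z w : CadlagPath e)
    (l : Ici e.1 ≃o Ici e.1) : ℝ≥0∞ :=
  ⨆ t : Ici e.1, edist (timeCutoff n (l t) * z.toFun (l t)) (timeCutoff n t * w.toFun t)

/-- The infimum over all increasing homeomorphisms `l` of `[s, ∞)` of the sum of the logarithmic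
slope of `l` and of `‖(k_n z) ∘ l - k_n w‖`. -/
noncomputable def pathDist {e : ℝ × ℝ} (n : ℕ) (z w : CadlagPath e) : ℝ≥0∞ :=
  ⨅ l : Ici e.1 ≃o Ici e.1, logSlope l + pathWarpedDist n z w l

theorem pathDist_comm_le {e : ℝ × ℝ} (n : ℕ) (z w : CadlagPath e) :
    pathDist n z w ≤ pathDist n w z := by
  refine le_iInf fun l => iInf_le_of_le l.symm
    (add_le_add (logSlope_symm_le l) (iSup_le fun t => le_iSup_of_le (l.symm t) ?_))
  rw [l.apply_symm_apply, edist_comm]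

/-- The Skorokhod metric `d_e` on `D_e`, inducing the Skorokhod (`J₁`) topology for the
unbounded time interval `[s, ∞)`. -/
noncomputable instance (e : ℝ × ℝ) : PseudoEMetricSpace (CadlagPath e) :=
  weightedEMetric pathDist
    (fun n z => le_antisymm (iInf_le_of_le (OrderIso.refl _) (by
      simp [logSlope_refl, pathWarpedDist])) bot_le)
    (fun n z w => le_antisymm (pathDist_comm_le n z w) (pathDist_comm_le n w z))
    (fun n z w v => by
      unfold pathDist
      refine ENNReal.le_iInf_add_iInf fun l m => iInf_le_of_le (m.trans l) ?_
      rw [add_add_add_comm]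
      refine add_le_add ((logSlope_trans_le m l).trans (add_comm _ _).le)
        (iSup_le fun t => ?_)
      exact (edist_triangle _ (timeCutoff n (m t) * w.toFun (m t)) _).trans
        (add_le_add (le_iSup_of_le (m t) le_rfl) (le_iSup_of_le t le_rfl)))

/-- The space `D_E = ∏_k D_{e_k}` for a sequence `E = (e_k)`. -/
def PathSeq (E : ℕ → ℝ × ℝ) : Type := (k : ℕ) → CadlagPath (E k)

/-- `D_E` carries the product topology, which is that of
`d_E (z, z') = ∑_k 2^{-k} (d_{e_k} (z_k, z'_k) ∧ 1)`. -/
noncomputable instance (E : ℕ → ℝ × ℝ) : TopologicalSpace (PathSeq E) :=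
  inferInstanceAs (TopologicalSpace ((k : ℕ) → CadlagPath (E k)))

noncomputable instance (E : ℕ → ℝ × ℝ) : MeasurableSpace (PathSeq E) := borel (PathSeq E)

instance (E : ℕ → ℝ × ℝ) : BorelSpace (PathSeq E) := ⟨rfl⟩

/-! The evaluation maps -/

namespace CadlagFlow

variable (φ : CadlagFlow)

theorem map_ioc_self (s : ℝ) : φ.toFun (BInterval.ioc s s) = DegreeOne.ident := by
  rw [← φ.map_empty]
  congr 1
  ext x; simp [BInterval.ioc, BInterval.empty]

theorem eventually_close_left (t : ℝ) {ε : ℝ} (hε : 0 < ε) : ∀ᶠ u in 𝓝[<] t, ∀ x,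
    |(φ.toFun (BInterval.ioo u t)).right x - x| ≤ ε ∧
      |(φ.toFun (BInterval.ioo u t)).left x - x| ≤ ε := by
  have h := (EMetric.tendsto_nhds.mp (φ.tendsto_left t)) (ENNReal.ofReal (ε / 2))
    (ENNReal.ofReal_pos.mpr (half_pos hε))
  filter_upwards [h] with u hu x
  simpa [mul_div_cancel₀] using DegreeOne.abs_sub_le_of_edist_lt hu x

theorem eventually_close_right_ioo (t : ℝ) {ε : ℝ} (hε : 0 < ε) : ∀ᶠ u in 𝓝[>] t, ∀ x,
    |(φ.toFun (BInterval.ioo t u)).right x - x| ≤ ε ∧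
      |(φ.toFun (BInterval.ioo t u)).left x - x| ≤ ε := by
  have h := (EMetric.tendsto_nhds.mp (φ.tendsto_right t)) (ENNReal.ofReal (ε / 2))
    (ENNReal.ofReal_pos.mpr (half_pos hε))
  filter_upwards [h] with u hu x
  simpa [mul_div_cancel₀] using DegreeOne.abs_sub_le_of_edist_lt hu x

theorem eventually_close_right (t : ℝ) {ε : ℝ} (hε : 0 < ε) : ∀ᶠ u in 𝓝[>] t, ∀ x,
    |(φ.toFun (BInterval.ioc t u)).right x - x| ≤ ε ∧
      |(φ.toFun (BInterval.ioc t u)).left x - x| ≤ ε := by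
  have h := φ.eventually_close_right_ioo t (half_pos hε)
  rw [eventually_nhdsWithin_iff] at h
  obtain ⟨δ, hδ, H⟩ := Metric.eventually_nhds_iff.mp h
  have hmem : Ioo t (t + δ) ∈ 𝓝[>] t := Ioo_mem_nhdsGT (by linarith)
  filter_upwards [hmem] with u hu x
  have hev := (φ.eventually_close_right_ioo u (half_pos hε)).and
    (Ioo_mem_nhdsGT hu.2)
  obtain ⟨w, hw1, hw2⟩ := hev.exists
  have hw3 := H (y := w) (by rw [Real.dist_eq, abs_lt]; constructor <;> linarith [hw2.1, hw2.2, hu.1])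
    (lt_trans hu.1 hw2.1)
  have hc := (φ.weak_flow _ _ _ (BInterval.isSum_ioc_ioo hu.1.le hw2.1)).close
    (fun y => (hw1 y).1) (fun y => (hw1 y).2) x
  have h1 := hw3 x
  simp only [abs_le] at hc h1 ⊢
  refine ⟨⟨?_, ?_⟩, ⟨?_, ?_⟩⟩ <;> linarith [hc.1.1, hc.1.2, hc.2.1, hc.2.2, h1.1.1, h1.1.2,
    h1.2.1, h1.2.2]

theorem right_continuousWithinAt (s x t : ℝ) (hst : s ≤ t) :
    ContinuousWithinAt (fun u => (φ.toFun (BInterval.ioc s u)).right x) (Ioi t) t ∧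
      ContinuousWithinAt (fun u => (φ.toFun (BInterval.ioc s u)).left x) (Ioi t) t := by
  have key : ∀ ε > 0, ∀ᶠ u in 𝓝[>] t,
      |(φ.toFun (BInterval.ioc s u)).right x - (φ.toFun (BInterval.ioc s t)).right x| ≤ ε ∧
      |(φ.toFun (BInterval.ioc s u)).left x - (φ.toFun (BInterval.ioc s t)).left x| ≤ ε := by
    intro ε hε
    filter_upwards [φ.eventually_close_right t hε, self_mem_nhdsWithin] with u hu htu
    exact (φ.weak_flow _ _ _ (BInterval.isSum_ioc_ioc hst (le_of_lt htu))).close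
      (fun y => (hu y).1) (fun y => (hu y).2) x
  constructor
  · refine Metric.tendsto_nhds.mpr fun ε hε => ?_
    filter_upwards [key (ε / 2) (half_pos hε)] with u hu
    exact lt_of_le_of_lt hu.1 (half_lt_self hε)
  · refine Metric.tendsto_nhds.mpr fun ε hε => ?_
    filter_upwards [key (ε / 2) (half_pos hε)] with u hu
    exact lt_of_le_of_lt hu.2 (half_lt_self hε)

theorem left_tendsto (s x t : ℝ) :
    Tendsto (fun u => (φ.toFun (BInterval.ioc s u)).right x) (𝓝[<] t ⊓ 𝓟 (Ici s))
        (𝓝 ((φ.toFun (BInterval.ioo s t)).right x)) ∧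
      Tendsto (fun u => (φ.toFun (BInterval.ioc s u)).left x) (𝓝[<] t ⊓ 𝓟 (Ici s))
        (𝓝 ((φ.toFun (BInterval.ioo s t)).left x)) := by
  have key : ∀ ε > 0, ∀ᶠ u in 𝓝[<] t ⊓ 𝓟 (Ici s),
      |(φ.toFun (BInterval.ioo s t)).right x - (φ.toFun (BInterval.ioc s u)).right x| ≤ ε ∧
      |(φ.toFun (BInterval.ioo s t)).left x - (φ.toFun (BInterval.ioc s u)).left x| ≤ ε := by
    intro ε hε
    rw [eventually_inf_principal]
    filter_upwards [φ.eventually_close_left t hε, self_mem_nhdsWithin] with u hu hut hsu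
    exact (φ.weak_flow _ _ _ (BInterval.isSum_ioc_ioo hsu hut)).close
      (fun y => (hu y).1) (fun y => (hu y).2) x
  constructor
  · refine Metric.tendsto_nhds.mpr fun ε hε => ?_
    filter_upwards [key (ε / 2) (half_pos hε)] with u hu
    rw [dist_comm]
    exact lt_of_le_of_lt hu.1 (half_lt_self hε)
  · refine Metric.tendsto_nhds.mpr fun ε hε => ?_
    filter_upwards [key (ε / 2) (half_pos hε)] with u hu
    rw [dist_comm]
    exact lt_of_le_of_lt hu.2 (half_lt_self hε)

theorem tendsto_val_Ioi {s : ℝ} (t : Ici s) :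
    Tendsto (Subtype.val : Ici s → ℝ) (𝓝[>] t) (𝓝[>] (t : ℝ)) :=
  tendsto_nhdsWithin_iff.mpr ⟨(continuous_subtype_val.tendsto t).mono_left nhdsWithin_le_nhds,
    eventually_nhdsWithin_of_forall fun _ hu => hu⟩

theorem tendsto_val_Iio {s : ℝ} (t : Ici s) :
    Tendsto (Subtype.val : Ici s → ℝ) (𝓝[<] t) (𝓝[<] (t : ℝ) ⊓ 𝓟 (Ici s)) :=
  tendsto_inf.mpr ⟨tendsto_nhdsWithin_iff.mpr
    ⟨(continuous_subtype_val.tendsto t).mono_left nhdsWithin_le_nhds,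
      eventually_nhdsWithin_of_forall fun _ hu => hu⟩,
    tendsto_principal.mpr (Eventually.of_forall fun u => u.2)⟩

/-- The path `Z^{e,+} (φ) = (φ_{(s,t]}⁺ x : t ≥ s)`, `e = (s, x)`. -/
noncomputable def pathRight (e : ℝ × ℝ) : CadlagPath e where
  toFun t := (φ.toFun (BInterval.ioc e.1 t)).right e.2
  start := by simp [map_ioc_self, DegreeOne.ident]
  right_continuous t := continuousWithinAt_Ioi_iff_Ici.mp
    ((φ.right_continuousWithinAt e.1 e.2 t t.2).1.tendsto.comp (tendsto_val_Ioi t))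
  left_limit t := ⟨_, (φ.left_tendsto e.1 e.2 t).1.comp (tendsto_val_Iio t)⟩

/-- The path `Z^{e,-} (φ) = (φ_{(s,t]}⁻ x : t ≥ s)`, `e = (s, x)`. -/
noncomputable def pathLeft (e : ℝ × ℝ) : CadlagPath e where
  toFun t := (φ.toFun (BInterval.ioc e.1 t)).left e.2
  start := by simp [map_ioc_self, DegreeOne.left_ident]
  right_continuous t := continuousWithinAt_Ioi_iff_Ici.mp
    ((φ.right_continuousWithinAt e.1 e.2 t t.2).2.tendsto.comp (tendsto_val_Ioi t))
  left_limit t := ⟨_, (φ.left_tendsto e.1 e.2 t).2.comp (tendsto_val_Iio t)⟩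

end CadlagFlow

/-- The map `Z^E = Z^{E,+} : D°(ℝ, 𝒟) → D_E`. -/
noncomputable def evalRight (E : ℕ → ℝ × ℝ) (φ : CadlagFlow) : PathSeq E :=
  fun k => φ.pathRight (E k)

/-- The map `Z^{E,-} : D°(ℝ, 𝒟) → D_E`. -/
noncomputable def evalLeft (E : ℕ → ℝ × ℝ) (φ : CadlagFlow) : PathSeq E :=
  fun k => φ.pathLeft (E k)

/-- The image on `D°(ℝ, 𝒟)` of a Borel probability measure on `C°(ℝ, 𝒟)` under the inclusion
`C°(ℝ, 𝒟) ⊆ D°(ℝ, 𝒟)`. -/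
noncomputable def onCadlag (μ : ProbabilityMeasure ContFlow) : ProbabilityMeasure CadlagFlow :=
  μ.map ContFlow.continuous_toCadlag.measurable.aemeasurable

end WeakFlow

/-!
The argument has two deterministic parts: the evaluation map `Z^E` is Borel, and it has a
continuous inverse at every continuous weak flow.

Continuity of the inverse (`comap_evalRight_le_nhds`). Let `φ` be a continuous weak flow, and let
`ψ` be a cadlag weak flow with `Z^E (ψ)` close to `Z^E (φ)`. Skorokhod convergence to a continuous
path is locally uniform (`CadlagPath.eventually_close`), so `ψ_{(s,t]}⁺ x` is close to
`φ_{(s,t]}⁺ x` for all `t` in a bounded window and for `(s, x)` in a finite grid of rational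
points. The distance `d_𝒟` is a Lévy distance (`DegreeOne.edist_le_iff`), so closeness of
non-decreasing maps of degree one on a fine grid of positions gives closeness in `𝒟`
(`DegreeOne.edist_le_of_grid`). For an arbitrary interval `I`, take a grid time `s` just before
`inf I`. Since `φ`, and hence `ψ`, hardly moves between `s` and `inf I`, the weak flow property
shows that `ψ_I` is close to its analogue for the interval from `s` to `sup I`, and likewise for
`φ` (`CadlagFlow.edist_le_of_ioc`). This bounds the distance in `D°(ℝ, 𝒟)`, with the identity as
time change.

Measurability (`measurable_evalRight`). A value `φ_{(s,t]}⁺ x` is the limit, as `δ ↓ 0`, of the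
supremum of `φ_{(a,b]}⁺ y` over `a ∈ (s, s + δ)`, `b ∈ (t, t + δ)`, `y ∈ (x, x + δ)`, and such a
supremum over an open box is lower semicontinuous in `φ`; so each value is Borel
(`measurable_eval`). A cadlag path is the Skorokhod limit of the step paths obtained by sampling it
on finer and finer grids (`CadlagPath.tendsto_sample`), and these depend continuously on countably
many values, so `Z^E` is a pointwise limit of Borel maps.

Weak convergence then transfers by the portmanteau theorem
(`tendsto_of_tendsto_map_evalRight`): for `F` closed, `limsup μ_n (F)` is at most the limiting mass
of the closure of `Z^E (F)`, and continuity of the inverse says that a continuous flow mapped into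
this closure belongs to `F`.
-/

namespace WeakFlow

/-! ### The metric on maps of degree one as a Lévy metric -/

namespace DegreeOne

theorem cross_eq_cross_fract (f : DegreeOne) (t : ℝ) : f.cross t = f.cross (Int.fract t) := by
  rw [← f.cross_add_int (Int.fract t) ⌊t⌋, Int.fract_add_floor]

theorem edist_le_iff_cross {f g : DegreeOne} {ε : ℝ} (hε : 0 ≤ ε) :
    edist f g ≤ ENNReal.ofReal ε ↔ ∀ t, |f.cross t - g.cross t| ≤ ε := by
  rw [edist_def]
  constructor
  · intro h t
    have h1 : ‖f.cross (Int.fract t) - g.cross (Int.fract t)‖ₑ ≤ ENNReal.ofReal ε :=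
      (le_iSup₂ (f := fun t (_ : t ∈ Ico (0 : ℝ) 1) => ‖f.cross t - g.cross t‖ₑ) (Int.fract t)
        ⟨Int.fract_nonneg t, Int.fract_lt_one t⟩).trans h
    rw [Real.enorm_eq_ofReal_abs, ENNReal.ofReal_le_ofReal_iff hε] at h1
    rwa [f.cross_eq_cross_fract, g.cross_eq_cross_fract]
  · intro h
    refine iSup₂_le fun t _ => ?_
    rw [Real.enorm_eq_ofReal_abs]
    exact ENNReal.ofReal_le_ofReal (h t)

theorem right_le_of_cross_le {f g : DegreeOne} {ε : ℝ}
    (h : ∀ t, |f.cross t - g.cross t| ≤ ε) (x : ℝ) : f.right x ≤ g.right (x + ε) + ε := by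
  have hlr := f.left_le_right x
  have h1 := h ((x + f.right x) / 2)
  have h2 := (g.cross_spec ((x + f.right x) / 2)).2
  rw [f.cross_eq (x := x) (by linarith) le_rfl, abs_le] at h1
  set y := (x + f.right x) / 2 - g.cross ((x + f.right x) / 2) with hy
  have h3 : g.right y ≤ g.right (x + ε) := g.monotone_right (by linarith [h1.2])
  linarith [h1.1, h1.2]

theorem cross_sub_le_of_right_le {f g : DegreeOne} {ε : ℝ}
    (h : ∀ x, f.right x ≤ g.right (x + ε) + ε) (t : ℝ) : f.cross t - g.cross t ≤ ε := by
  by_contra hc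
  push Not at hc
  have h1 := (f.cross_spec t).2
  have h2 := (g.cross_spec t).1
  have h3 := h (t - f.cross t)
  have h4 := g.right_le_left (x := t - f.cross t + ε) (y := t - g.cross t) (by linarith)
  linarith

/-- The distance `d_𝒟` is the Lévy distance: its balls are described by shifting the completed
graphs by `ε` along both axes. -/
theorem edist_le_iff {f g : DegreeOne} {ε : ℝ} (hε : 0 ≤ ε) :
    edist f g ≤ ENNReal.ofReal ε ↔
      ∀ x, f.right x ≤ g.right (x + ε) + ε ∧ g.right x ≤ f.right (x + ε) + ε := by
  rw [edist_le_iff_cross hε]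
  constructor
  · intro h x
    exact ⟨right_le_of_cross_le h x,
      right_le_of_cross_le (fun t => by rw [abs_sub_comm]; exact h t) x⟩
  · intro h t
    rw [abs_le]
    constructor
    · linarith [cross_sub_le_of_right_le (fun x => (h x).2) t]
    · exact cross_sub_le_of_right_le (fun x => (h x).1) t

theorem edist_le_of_abs_right_sub_le {f g : DegreeOne} {ε : ℝ}
    (h : ∀ x, |f.right x - g.right x| ≤ ε) : edist f g ≤ ENNReal.ofReal ε := by
  have hε : 0 ≤ ε := (abs_nonneg _).trans (h 0)
  refine (edist_le_iff hε).mpr fun x => ?_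
  have h1 := abs_le.mp (h x)
  have h2 := f.monotone_right (show x ≤ x + ε by linarith)
  have h3 := g.monotone_right (show x ≤ x + ε by linarith)
  constructor <;> linarith [h1.1, h1.2]

theorem abs_sub_le_of_edist_le {f : DegreeOne} {ε : ℝ} (hε : 0 ≤ ε)
    (h : edist f ident ≤ ENNReal.ofReal ε) (x : ℝ) :
    |f.right x - x| ≤ 2 * ε ∧ |f.left x - x| ≤ 2 * ε := by
  have H := (edist_le_iff hε).mp h
  have hup : ∀ y, f.right y ≤ y + 2 * ε := fun y => by
    have := (H y).1
    simp only [ident] at this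
    linarith
  have hlow : ∀ y, y - 2 * ε ≤ f.right y := fun y => by
    have := (H (y - ε)).2
    simp only [ident, sub_add_cancel] at this
    linarith
  have hl : x - 2 * ε ≤ f.left x := by
    have h1 : Tendsto (fun y : ℝ => y - 2 * ε) (𝓝[<] x) (𝓝 (x - 2 * ε)) :=
      ((continuous_id.sub continuous_const).tendsto x).mono_left nhdsWithin_le_nhds
    exact le_of_tendsto_of_tendsto' h1 (f.tendsto_left x) hlow
  have := f.left_le_right x
  exact ⟨abs_le.mpr ⟨by linarith [hlow x], by linarith [hup x]⟩,
    abs_le.mpr ⟨by linarith, by linarith [hup x]⟩⟩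

/-- Two maps of degree one which are close at the points `0, 1/p, …, (p-1)/p` are close. -/
theorem edist_le_of_grid {f g : DegreeOne} {ε : ℝ} {p : ℕ} (hp : 0 < p) (hpε : 1 / (p : ℝ) ≤ ε)
    (h : ∀ i < p, |f.right ((i : ℝ) / p) - g.right ((i : ℝ) / p)| ≤ ε) :
    edist f g ≤ ENNReal.ofReal ε := by
  have hp' : (0 : ℝ) < p := by exact_mod_cast hp
  have hε : 0 ≤ ε := le_trans (by positivity) hpε
  have hint : ∀ i : ℤ, |f.right ((i : ℝ) / p) - g.right ((i : ℝ) / p)| ≤ ε := by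
    intro i
    have hpz : (0 : ℤ) < p := by exact_mod_cast hp
    obtain ⟨j, hj⟩ := Int.eq_ofNat_of_zero_le (Int.emod_nonneg i hpz.ne')
    have hjp : j < p := by
      have := Int.emod_lt_of_pos i hpz
      omega
    have hi : (i : ℝ) / p = (j : ℝ) / p + (i / p : ℤ) := by
      have h1 : (i : ℝ) = (p : ℝ) * ((i / p : ℤ) : ℝ) + (j : ℝ) := by
        have h2 := Int.mul_ediv_add_emod i p
        rw [hj] at h2
        exact_mod_cast h2.symm
      rw [h1]
      field_simp
      ring
    rw [hi, f.degree_one, g.degree_one, add_sub_add_right_eq_sub]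
    exact h j hjp
  have key : ∀ f g : DegreeOne, (∀ i : ℤ, |f.right ((i : ℝ) / p) - g.right ((i : ℝ) / p)| ≤ ε) →
      ∀ x, f.right x ≤ g.right (x + ε) + ε := by
    intro f g h x
    have h1 : x ≤ (⌈x * p⌉ : ℝ) / p := by
      rw [le_div_iff₀ hp']
      exact Int.le_ceil _
    have h2 : (⌈x * p⌉ : ℝ) / p ≤ x + ε := by
      have h3 : (⌈x * p⌉ : ℝ) / p ≤ (x * p + 1) / p :=
        div_le_div_of_nonneg_right (Int.ceil_lt_add_one _).le hp'.le
      rw [add_div, mul_div_cancel_right₀ _ hp'.ne'] at h3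
      linarith
    linarith [f.monotone_right h1, g.monotone_right h2, (abs_le.mp (h ⌈x * p⌉)).2]
  exact (edist_le_iff hε).mpr fun x => ⟨key f g hint x,
    key g f (fun i => by rw [abs_sub_comm]; exact hint i) x⟩

/-- If `g` is uniformly close to the identity, then `h` is close to `f`. -/
theorem WeakComp.edist_le_of_left {g f h : DegreeOne} (H : WeakComp g f h) {ε : ℝ}
    (hg : ∀ x, |g.right x - x| ≤ ε ∧ |g.left x - x| ≤ ε) : edist h f ≤ ENNReal.ofReal ε :=
  edist_le_of_abs_right_sub_le fun x => (H.close (fun y => (hg y).1) (fun y => (hg y).2) x).1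

/-- Together with `WeakComp.right_le_of_right`: an upper bound on `g` near `x` comes from the left
inequality `g⁻ ∘ f⁻ ≤ h⁻`, a lower bound from the right one. -/
theorem WeakComp.left_le_of_right {g f h : DegreeOne} (H : WeakComp g f h) {ε : ℝ}
    (hf : ∀ x, |f.right x - x| ≤ ε ∧ |f.left x - x| ≤ ε) (x : ℝ) :
    g.left (x - ε) ≤ h.left x :=
  (g.monotone_right.leftLim (by linarith [(abs_le.mp (hf x).2).1])).trans (H x).1

theorem WeakComp.right_le_of_right {g f h : DegreeOne} (H : WeakComp g f h) {ε : ℝ}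
    (hf : ∀ x, |f.right x - x| ≤ ε ∧ |f.left x - x| ≤ ε) (x : ℝ) :
    h.right x ≤ g.right (x + ε) :=
  (H x).2.2.trans (g.monotone_right (by linarith [(abs_le.mp (hf x).1).2]))

/-- If `f` is uniformly close to the identity, then `h` is close to `g`. -/
theorem WeakComp.edist_le_of_right {g f h : DegreeOne} (H : WeakComp g f h) {ε : ℝ} (hε : 0 < ε)
    (hf : ∀ x, |f.right x - x| ≤ ε ∧ |f.left x - x| ≤ ε) : edist h g ≤ ENNReal.ofReal (2 * ε) := by
  refine (edist_le_iff (by linarith)).mpr fun x => ⟨?_, ?_⟩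
  · linarith [H.right_le_of_right hf x, g.monotone_right (show x + ε ≤ x + 2 * ε by linarith)]
  · have h1 := H.left_le_of_right hf (x + 2 * ε)
    have h2 := g.right_le_left (show x < x + 2 * ε - ε by linarith)
    linarith [h.left_le_right (x + 2 * ε)]

end DegreeOne

/-! ### Convergence for weighted sums of metrics -/

/-- A small weighted sum has small terms. The index is shifted because the sum starts at `d 1`. -/
theorem exists_lt_of_weightedSum_lt (n : ℕ) {r : ℝ≥0∞} (hr : 0 < r) :
    ∃ ρ > 0, ∀ d : ℕ → ℝ≥0∞, weightedSum d < ρ → d (n + 1) < r := by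
  have h2 : (2⁻¹ : ℝ≥0∞) ^ (n + 1) ≠ 0 := pow_ne_zero _ (by simp)
  have h2' : (2⁻¹ : ℝ≥0∞) ^ (n + 1) ≠ ∞ := ENNReal.pow_ne_top (by simp)
  refine ⟨(2⁻¹ : ℝ≥0∞) ^ (n + 1) * min r 1, ?_, fun d hd => ?_⟩
  · exact ENNReal.mul_pos h2 (lt_min hr one_pos).ne'
  · have h1 := (ENNReal.le_tsum (f := fun n => (2⁻¹ : ℝ≥0∞) ^ (n + 1) * min (d (n + 1)) 1) n).trans_lt
      hd
    rw [ENNReal.mul_lt_mul_iff_right h2 h2'] at h1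
    by_contra hc
    exact absurd h1 (not_lt.mpr (min_le_min_right _ (not_lt.mp hc)))

theorem tendsto_weightedSum {ι : Type*} {l : Filter ι} {d : ι → ℕ → ℝ≥0∞}
    (h : ∀ n, Tendsto (fun i => d i n) l (𝓝 0)) : Tendsto (fun i => weightedSum (d i)) l (𝓝 0) := by
  have hsum : ∑' n : ℕ, (2⁻¹ : ℝ≥0∞) ^ (n + 1) ≠ ∞ := by
    simp_rw [pow_succ]
    rw [ENNReal.tsum_mul_right, ENNReal.tsum_geometric]
    simp
  refine ENNReal.tendsto_nhds_zero.mpr fun ε hε => ?_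
  obtain ⟨s, hs⟩ := ((ENNReal.tendsto_nhds_zero.mp
    (ENNReal.tendsto_tsum_compl_atTop_zero hsum)) (ε / 2) (ENNReal.half_pos hε.ne')).exists
  have h1 : Tendsto (fun i => ∑ n ∈ s, (2⁻¹ : ℝ≥0∞) ^ (n + 1) * min (d i (n + 1)) 1) l (𝓝 0) := by
    have h2 : Tendsto (fun i => ∑ n ∈ s, d i (n + 1)) l (𝓝 0) := by
      simpa using tendsto_finsetSum s fun n _ => h (n + 1)
    refine tendsto_of_tendsto_of_tendsto_of_le_of_le tendsto_const_nhds h2 (fun _ => bot_le)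
      fun i => Finset.sum_le_sum fun n _ => ?_
    refine (mul_le_mul' (pow_le_one' ?_ _) (min_le_left _ _)).trans_eq (one_mul _)
    simp
  filter_upwards [(ENNReal.tendsto_nhds_zero.mp h1) (ε / 2) (ENNReal.half_pos hε.ne')] with i hi
  unfold weightedSum
  rw [← Summable.tsum_add_tsum_compl (s := (s : Set ℕ)) ENNReal.summable ENNReal.summable,
    Finset.tsum_subtype' s (fun n => (2⁻¹ : ℝ≥0∞) ^ (n + 1) * min (d i (n + 1)) 1),
    ← ENNReal.add_halves ε]
  refine add_le_add hi (le_trans (ENNReal.tsum_le_tsum fun n => ?_) hs)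
  exact (mul_le_mul_right (min_le_right _ _) _).trans_eq (mul_one _)

theorem edist_triangle_ofReal {α : Type*} [PseudoEMetricSpace α] {x y z : α} {a b : ℝ}
    (ha : 0 ≤ a) (hb : 0 ≤ b) (hxy : edist x y ≤ ENNReal.ofReal a)
    (hyz : edist y z ≤ ENNReal.ofReal b) : edist x z ≤ ENNReal.ofReal (a + b) := by
  rw [ENNReal.ofReal_add ha hb]
  exact (edist_triangle _ _ _).trans (add_le_add hxy hyz)

/-! ### Continuous weak flows -/

namespace ContFlow

theorem toCadlag_ioc (φ : ContFlow) {s t : ℝ} (h : s ≤ t) :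
    φ.toCadlag.toFun (BInterval.ioc s t) = φ.toFun s t := by
  rcases h.eq_or_lt with rfl | h
  · rw [CadlagFlow.map_ioc_self, φ.map_of_le _ _ le_rfl]
  · simp [toCadlag, BInterval.ioc, csInf_Ioc h, csSup_Ioc h]

theorem toCadlag_ioo (φ : ContFlow) {s t : ℝ} (h : s < t) :
    φ.toCadlag.toFun (BInterval.ioo s t) = φ.toFun s t := by
  simp [toCadlag, BInterval.ioo, csInf_Ioo h, csSup_Ioo h]

/-- Near a time `t`, the increments of `φ` over intervals starting or ending at `t` are close to the
identity, and by the weak flow property so are all increments. -/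
theorem exists_local_modulus (φ : ContFlow) (t : ℝ) {ε : ℝ} (hε : 0 < ε) :
    ∃ r > 0, ∀ u v, t - r < u → u < v → v < t + r →
      edist (φ.toFun u v) DegreeOne.ident ≤ ENNReal.ofReal ε := by
  have hε8 : 0 < ε / 8 := by linarith
  have hl := (EMetric.tendsto_nhds.mp (φ.tendsto_left t)) _ (ENNReal.ofReal_pos.mpr hε8)
  have hr := (EMetric.tendsto_nhds.mp (φ.tendsto_right t)) _ (ENNReal.ofReal_pos.mpr hε8)
  obtain ⟨a, ha, hl⟩ := mem_nhdsLT_iff_exists_Ioo_subset.mp hl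
  obtain ⟨b, hb, hr⟩ := mem_nhdsGT_iff_exists_Ioo_subset.mp hr
  have hab (f : DegreeOne) (h : edist f DegreeOne.ident < ENNReal.ofReal (ε / 8)) (x : ℝ) :
      |f.right x - x| ≤ ε / 4 ∧ |f.left x - x| ≤ ε / 4 := by
    have := DegreeOne.abs_sub_le_of_edist_lt h x
    rwa [show 2 * (ε / 8) = ε / 4 by ring] at this
  refine ⟨min (t - a) (b - t), lt_min (sub_pos.mpr ha) (sub_pos.mpr hb), fun u v hu huv hv => ?_⟩
  have hau : a < u := by linarith [min_le_left (t - a) (b - t)]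
  have hvb : v < b := by linarith [min_le_right (t - a) (b - t)]
  have hL : ∀ w, a < w → w < t → edist (φ.toFun w t) DegreeOne.ident < ENNReal.ofReal (ε / 8) :=
    fun w h1 h2 => hl ⟨h1, h2⟩
  have hR : ∀ w, t < w → w < b → edist (φ.toFun t w) DegreeOne.ident < ENNReal.ofReal (ε / 8) :=
    fun w h1 h2 => hr ⟨h1, h2⟩
  have hle : ∀ {c : ℝ}, c ≤ ε → ∀ {f : DegreeOne}, edist f DegreeOne.ident ≤ ENNReal.ofReal c →
      edist f DegreeOne.ident ≤ ENNReal.ofReal ε :=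
    fun hc _ h => h.trans (ENNReal.ofReal_le_ofReal hc)
  rcases lt_trichotomy v t with hvt | rfl | htv
  · have h1 := (φ.weak_flow u v t huv hvt).edist_le_of_left
      (hab _ (hL v (hau.trans huv) hvt))
    rw [edist_comm] at h1
    exact hle (by linarith) (edist_triangle_ofReal (by linarith) hε8.le h1
      (hL u hau (huv.trans hvt)).le)
  · exact hle (by linarith) (hL u hau huv).le
  · rcases lt_trichotomy u t with hut | rfl | htu
    · have h1 := (φ.weak_flow u t v hut htv).edist_le_of_left (hab _ (hR v htv hvb))
      exact hle (by linarith) (edist_triangle_ofReal (by linarith) hε8.le h1 (hL u hau hut).le)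
    · exact hle (by linarith) (hR v htv hvb).le
    · have h1 := (φ.weak_flow t u v htu huv).edist_le_of_right (by linarith)
        (hab _ (hR u htu (huv.trans hvb)))
      rw [edist_comm] at h1
      exact hle (by linarith) (edist_triangle_ofReal (by linarith) hε8.le h1 (hR v htv hvb).le)

/-- A continuous weak flow is uniformly close to the identity over short time intervals, locally
uniformly in time. -/
theorem exists_modulus (φ : ContFlow) (N : ℝ) {ε : ℝ} (hε : 0 < ε) :
    ∃ δ > 0, ∀ u v, -N ≤ u → u ≤ N → u ≤ v → v < u + δ →
      edist (φ.toFun u v) DegreeOne.ident ≤ ENNReal.ofReal ε := by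
  choose r hr H using fun t => φ.exists_local_modulus t hε
  obtain ⟨δ, hδ, hc⟩ := lebesgue_number_lemma_of_metric (isCompact_Icc (a := -N) (b := N))
    (fun t => Metric.isOpen_ball (x := t) (ε := r t))
    (fun t _ => mem_iUnion.mpr ⟨t, Metric.mem_ball_self (hr t)⟩)
  refine ⟨δ, hδ, fun u v h1 h2 huv hv => ?_⟩
  rcases huv.eq_or_lt with rfl | huv
  · simp [φ.map_of_le _ _ le_rfl]
  obtain ⟨t, ht⟩ := hc u ⟨h1, h2⟩
  have hu := ht (Metric.mem_ball_self hδ)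
  have hv' := ht (show v ∈ Metric.ball u δ by
    rw [Metric.mem_ball, Real.dist_eq, abs_lt]; constructor <;> linarith)
  rw [Metric.mem_ball, Real.dist_eq, abs_lt] at hu hv'
  exact H t u v (by linarith) huv (by linarith)

theorem continuous_pathRight (φ : ContFlow) (e : ℝ × ℝ) :
    Continuous (φ.toCadlag.pathRight e).toFun := by
  refine continuous_iff_continuousAt.mpr fun t =>
    continuousAt_iff_continuous_left'_right'.mpr ⟨?_,
      continuousWithinAt_Ioi_iff_Ici.mpr ((φ.toCadlag.pathRight e).right_continuous t)⟩
  rcases (show e.1 ≤ t from t.2).eq_or_lt with h | h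
  · have h0 : Iio t = ∅ := by
      ext u
      simp only [mem_Iio, mem_empty_iff_false, iff_false, not_lt, ← Subtype.coe_le_coe, ← h]
      exact u.2
    rw [h0, ContinuousWithinAt, nhdsWithin_empty]
    exact tendsto_bot
  · have h1 := (φ.toCadlag.left_tendsto e.1 e.2 t).1.comp (CadlagFlow.tendsto_val_Iio t)
    rwa [toCadlag_ioo φ h, ← toCadlag_ioc φ h.le] at h1

end ContFlow

/-! ### Comparing two cadlag weak flows through finitely many starting times -/

/-- A nonempty interval `I` extends on the left to an interval `H` of the form `(s, b]` or `(s, b)`;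
the added part `J` is `(s, a]` or `(s, a)`, according to whether `a = inf I` belongs to `I`. -/
theorem BInterval.exists_isSum (I : BInterval) (hne : I.carrier.Nonempty) {s : ℝ}
    (hs : s < sInf I.carrier) :
    ∃ J H : BInterval, (J = ioc s (sInf I.carrier) ∨ J = ioo s (sInf I.carrier)) ∧
      (H = ioc s (sSup I.carrier) ∨ H = ioo s (sSup I.carrier)) ∧ IsSum H J I := by
  classical
  set a := sInf I.carrier with ha
  set b := sSup I.carrier with hb
  have hIa : ∀ x ∈ I.carrier, a ≤ x := fun x hx => csInf_le I.bddBelow hx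
  have hIb : ∀ x ∈ I.carrier, x ≤ b := fun x hx => le_csSup I.bddAbove hx
  have hmid : ∀ x, a < x → x < b → x ∈ I.carrier := fun x h1 h2 => by
    obtain ⟨i, hi, hix⟩ := exists_lt_of_csInf_lt hne h1
    obtain ⟨j, hj, hxj⟩ := exists_lt_of_lt_csSup hne h2
    exact I.ordConnected.out hi hj ⟨hix.le, hxj.le⟩
  refine ⟨if a ∈ I.carrier then ioo s a else ioc s a,
    if b ∈ I.carrier then ioc s b else ioo s b, by split_ifs <;> simp, by split_ifs <;> simp, ?_, ?_⟩
  · ext x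
    obtain ⟨y, hy⟩ := hne
    have hab : a ≤ b := (hIa y hy).trans (hIb y hy)
    have hne' : a = b → a ∈ I.carrier := fun h => by
      rwa [show a = y from le_antisymm (hIa y hy) (h ▸ hIb y hy)]
    have hxa : x = a → (x ∈ I.carrier ↔ a ∈ I.carrier) := fun h => by rw [h]
    have hxb : x = b → (x ∈ I.carrier ↔ b ∈ I.carrier) := fun h => by rw [h]
    have h1 := hIa x
    have h2 := hIb x
    have h3 := hmid x
    have hab' : a = b → (a ∈ I.carrier ↔ b ∈ I.carrier) := fun h => by rw [h]
    split_ifs with h4 h5 h5 <;> simp only [ioc, ioo, mem_union, mem_Ioc, mem_Ioo] <;> grind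
  · intro x hx y hy
    have := hIa y hy
    split_ifs at hx with h4
    · exact lt_of_lt_of_le hx.2 this
    · exact lt_of_le_of_lt hx.2 (lt_of_le_of_ne this fun h => h4 (h ▸ hy))

namespace CadlagFlow

theorem eventually_edist_ioo_ioc (ψ : CadlagFlow) {s b : ℝ} (hsb : s < b) {ε : ℝ} (hε : 0 < ε) :
    ∀ᶠ u in 𝓝[<] b, edist (ψ.toFun (BInterval.ioo s b)) (ψ.toFun (BInterval.ioc s u)) ≤
      ENNReal.ofReal ε := by
  filter_upwards [ψ.eventually_close_left b hε, Ioo_mem_nhdsLT hsb] with u hu hsu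
  exact (ψ.weak_flow _ _ _ (BInterval.isSum_ioc_ioo hsu.1.le hsu.2)).edist_le_of_left hu

theorem edist_le_of_ioc_or_ioo (ψ χ : CadlagFlow) {s b ε : ℝ} (hsb : s < b) (hε : 0 < ε)
    (H : ∀ t, s < t → t ≤ b → edist (ψ.toFun (BInterval.ioc s t)) (χ.toFun (BInterval.ioc s t)) ≤
      ENNReal.ofReal ε) {J : BInterval} (hJ : J = BInterval.ioc s b ∨ J = BInterval.ioo s b) :
    edist (ψ.toFun J) (χ.toFun J) ≤ ENNReal.ofReal (3 * ε) := by
  rcases hJ with rfl | rfl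
  · exact (H b hsb le_rfl).trans (ENNReal.ofReal_le_ofReal (by linarith))
  · obtain ⟨u, ⟨h1, h2⟩, h3⟩ := ((ψ.eventually_edist_ioo_ioc hsb hε).and
      (χ.eventually_edist_ioo_ioc hsb hε) |>.and (Ioo_mem_nhdsLT hsb)).exists
    rw [edist_comm] at h2
    rw [show 3 * ε = ε + ε + ε by ring]
    exact edist_triangle_ofReal (by linarith) hε.le
      (edist_triangle_ofReal hε.le hε.le h1 (H u h3.1 h3.2.le)) h2

theorem edist_ident_le_of_ioc_or_ioo (ψ : CadlagFlow) {s b ε : ℝ} (hsb : s < b) (hε : 0 < ε)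
    (H : ∀ t, s < t → t ≤ b → edist (ψ.toFun (BInterval.ioc s t)) DegreeOne.ident ≤
      ENNReal.ofReal ε) {J : BInterval} (hJ : J = BInterval.ioc s b ∨ J = BInterval.ioo s b) :
    edist (ψ.toFun J) DegreeOne.ident ≤ ENNReal.ofReal (2 * ε) := by
  rcases hJ with rfl | rfl
  · exact (H b hsb le_rfl).trans (ENNReal.ofReal_le_ofReal (by linarith))
  · obtain ⟨u, h1, h3⟩ := ((ψ.eventually_edist_ioo_ioc hsb hε).and (Ioo_mem_nhdsLT hsb)).exists
    rw [show 2 * ε = ε + ε by ring]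
    exact edist_triangle_ofReal hε.le hε.le h1 (H u h3.1 h3.2.le)

/-- To compare `ψ_I` and `χ_I`, extend `I` on the left to an interval starting just after a
time `s < inf I`: if both flows hardly move between `s` and `inf I`, then the weak flow property
says that this changes `ψ_I` and `χ_I` only little. -/
theorem edist_le_of_ioc (ψ χ : CadlagFlow) {I : BInterval} (hne : I.carrier.Nonempty) {s ε : ℝ}
    (hs : s < sInf I.carrier) (hε : 0 < ε)
    (H : ∀ t, s < t → t ≤ sSup I.carrier →
      edist (ψ.toFun (BInterval.ioc s t)) (χ.toFun (BInterval.ioc s t)) ≤ ENNReal.ofReal ε)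
    (hχ : ∀ t, s < t → t ≤ sInf I.carrier →
      edist (χ.toFun (BInterval.ioc s t)) DegreeOne.ident ≤ ENNReal.ofReal ε) :
    edist (ψ.toFun I) (χ.toFun I) ≤ ENNReal.ofReal (27 * ε) := by
  have hle := csInf_le_csSup hne I.bddBelow I.bddAbove
  obtain ⟨J, K, hJ, hK, hsum⟩ := I.exists_isSum hne hs
  have h1 := edist_le_of_ioc_or_ioo ψ χ (hs.trans_le hle) hε H hK
  have h2 := edist_ident_le_of_ioc_or_ioo χ hs hε hχ hJ
  have h3 := edist_ident_le_of_ioc_or_ioo ψ hs (ε := ε + ε) (by linarith)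
    (fun t ht ht' => edist_triangle_ofReal hε.le hε.le (H t ht (ht'.trans hle)) (hχ t ht ht')) hJ
  have h4 := (ψ.weak_flow _ _ _ hsum).edist_le_of_right (by linarith)
    (DegreeOne.abs_sub_le_of_edist_le (by linarith) h3)
  have h5 := (χ.weak_flow _ _ _ hsum).edist_le_of_right (by linarith)
    (DegreeOne.abs_sub_le_of_edist_le (by linarith) h2)
  rw [edist_comm] at h4
  refine (edist_triangle_ofReal (by linarith) (by linarith)
    (edist_triangle_ofReal (by linarith) (by linarith) h4 h1) h5).trans_eq ?_
  congr 1
  ring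

/-- The identity time change bounds `d_D^{(n)}` by a uniform distance over the intervals which are
not cut off. -/
theorem cadlagDist_le (n : ℕ) (ψ χ : CadlagFlow) (c : ℝ≥0∞)
    (H : ∀ I : BInterval, I.carrier.Nonempty → -((n : ℝ) + 1) < sInf I.carrier →
      sSup I.carrier < n + 1 → edist (ψ.toFun I) (χ.toFun I) ≤ c) :
    cadlagDist n ψ χ ≤ c := by
  refine iInf_le_of_le (OrderIso.refl ℝ) ?_
  rw [distortion_refl]
  refine sup_le bot_le (iSup_le fun I => ?_)
  rw [BInterval.image_refl]
  have hc0 : 0 ≤ I.cutoff n := le_max_left _ _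
  have hc1 : I.cutoff n ≤ 1 := max_le zero_le_one (min_le_right _ _)
  rcases hc0.eq_or_lt with h | h
  · simp [← h, circleNorm_zero]
  have hR : max (sSup I.carrier) (-sInf I.carrier) < n + 1 := by
    by_contra hc
    push Not at hc
    have h2 : min ((n : ℝ) + 1 - max (sSup I.carrier) (-sInf I.carrier)) 1 ≤ 0 :=
      (min_le_left _ _).trans (by linarith)
    exact absurd (max_eq_left h2) h.ne'
  obtain ⟨hR1, hR2⟩ := max_lt_iff.mp hR
  refine le_trans (b := edist (ψ.toFun I) (χ.toFun I)) ?_ ?_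
  · rw [DegreeOne.edist_def]
    refine iSup₂_mono fun t _ => ?_
    dsimp only
    rw [← mul_sub, Real.enorm_eq_ofReal_abs, Real.enorm_eq_ofReal_abs]
    refine ENNReal.ofReal_le_ofReal ?_
    rw [abs_mul, abs_of_nonneg hc0]
    exact mul_le_of_le_one_left (abs_nonneg _) hc1
  · rcases I.carrier.eq_empty_or_nonempty with he | hne
    · have hI : I = BInterval.empty := BInterval.ext he
      rw [hI, ψ.map_empty, χ.map_empty, edist_self]
      exact bot_le
    · exact H I hne (by linarith) hR1

end CadlagFlow

/-! ### Skorokhod convergence to a continuous path -/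

theorem timeCutoff_eq_one {s : ℝ} {n : ℕ} {t : Ici s} (h : (t : ℝ) ≤ s + n) :
    timeCutoff n t = 1 := by
  unfold timeCutoff
  rw [min_eq_right (by linarith), max_eq_right zero_le_one]

theorem orderIso_Ici_start {s : ℝ} (l : Ici s ≃o Ici s) :
    l ⟨s, self_mem_Ici⟩ = ⟨s, self_mem_Ici⟩ :=
  l.map_bot

/-- A time change of `[s, ∞)` with slopes close to one is close to the identity on bounded sets. -/
theorem abs_sub_le_of_logSlope {s : ℝ} (l : Ici s ≃o Ici s) {η : ℝ} (hη : η ≤ 1) (hη0 : 0 ≤ η)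
    (h : logSlope l ≤ ENNReal.ofReal η) (t : Ici s) : |(l t : ℝ) - t| ≤ 2 * η * (t - s) := by
  rcases (show s ≤ t from t.2).eq_or_lt with hst | hst
  · have : t = ⟨s, self_mem_Ici⟩ := Subtype.ext hst.symm
    rw [this, orderIso_Ici_start]
    simp
  · have hlt : (⟨s, self_mem_Ici⟩ : Ici s) < t := hst
    have h1 := h
    simp only [logSlope, iSup_le_iff] at h1
    replace h1 := h1 ⟨s, self_mem_Ici⟩ t hlt
    rw [ENNReal.ofReal_le_ofReal_iff hη0] at h1
    have hl := l.strictMono hlt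
    rw [orderIso_Ici_start] at h1 hl
    have hl' : s < l t := hl
    have hpos : 0 < ((l t : ℝ) - s) / (t - s) := div_pos (sub_pos.mpr hl') (sub_pos.mpr hst)
    have h2 := Real.abs_exp_sub_one_le (h1.trans hη)
    simp only [Real.exp_log hpos] at h2
    have h3 : (l t : ℝ) - t = (((l t : ℝ) - s) / (t - s) - 1) * (t - s) := by
      field_simp [(sub_pos.mpr hst).ne']
      ring
    rw [h3, abs_mul, abs_of_pos (sub_pos.mpr hst)]
    exact mul_le_mul_of_nonneg_right (h2.trans (by linarith)) (sub_pos.mpr hst).le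

theorem eventually_pathDist_lt {e : ℝ × ℝ} (w : CadlagPath e) (n : ℕ) {r : ℝ≥0∞} (hr : 0 < r) :
    ∀ᶠ z in 𝓝 w, pathDist (n + 1) z w < r := by
  obtain ⟨ρ, hρ, H⟩ := exists_lt_of_weightedSum_lt n hr
  filter_upwards [Metric.eball_mem_nhds w hρ] with z hz
  exact H (fun n => pathDist n z w) hz

/-- Skorokhod convergence to a continuous path is locally uniform. -/
theorem CadlagPath.eventually_close {e : ℝ × ℝ} (w : CadlagPath e) (hw : Continuous w.toFun)
    (T : ℝ) {ε : ℝ} (hε : 0 < ε) :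
    ∀ᶠ z in 𝓝 w, ∀ t : Ici e.1, (t : ℝ) ≤ e.1 + T → |z.toFun t - w.toFun t| ≤ ε := by
  obtain ⟨n, hn⟩ := exists_nat_ge T
  have hW : Continuous fun t : ℝ => w.toFun ⟨max e.1 t, mem_Ici.mpr (le_max_left _ _)⟩ :=
    hw.comp (Continuous.subtype_mk (continuous_const.max continuous_id) _)
  obtain ⟨δ, hδ, hunif⟩ := Metric.uniformContinuousOn_iff.mp
    ((isCompact_Icc (a := e.1) (b := e.1 + n + 1)).uniformContinuousOn_of_continuous
      hW.continuousOn) (ε / 2) (half_pos hε)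
  have hn0 : (0 : ℝ) ≤ n := Nat.cast_nonneg n
  set η := min (ε / 2) (min 1 (min δ 1 / (4 * (n + 1)))) with hηdef
  have hη : 0 < η := by positivity
  have hη1 : η ≤ 1 := (min_le_right _ _).trans (min_le_left _ _)
  have hη2 : η ≤ ε / 2 := min_le_left _ _
  have hη3 : 2 * η * n < min δ 1 := by
    have h1 : η ≤ min δ 1 / (4 * (n + 1)) := (min_le_right _ _).trans (min_le_right _ _)
    rw [le_div_iff₀ (by positivity)] at h1
    nlinarith [lt_min hδ one_pos]
  filter_upwards [eventually_pathDist_lt w n (ENNReal.ofReal_pos.mpr hη)] with z hz t ht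
  obtain ⟨l, hl⟩ := iInf_lt_iff.mp ((pathDist_comm_le (n + 1) w z).trans_lt hz)
  have hts : (t : ℝ) - e.1 ≤ n := by linarith
  have hts0 : e.1 ≤ t := t.2
  have h1 := abs_sub_le_of_logSlope l hη1 hη.le ((le_self_add).trans hl.le) t
  have h2 : |(l t : ℝ) - t| < min δ 1 :=
    (h1.trans (mul_le_mul_of_nonneg_left hts (by positivity))).trans_lt hη3
  have h3 : edist (timeCutoff (n + 1) (l t) * w.toFun (l t)) (timeCutoff (n + 1) t * z.toFun t) ≤
      ENNReal.ofReal η :=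
    ((le_iSup (fun t => edist (timeCutoff (n + 1) (l t) * w.toFun (l t))
      (timeCutoff (n + 1) t * z.toFun t)) t).trans le_add_self).trans hl.le
  have h4 : (l t : ℝ) ≤ t + 1 := by
    linarith [(abs_lt.mp (h2.trans_le (min_le_right _ _))).2]
  rw [timeCutoff_eq_one (by push_cast; linarith), timeCutoff_eq_one (by push_cast; linarith),
    one_mul, one_mul, edist_dist, ENNReal.ofReal_le_ofReal_iff hη.le, Real.dist_eq] at h3
  have h5 := hunif (l t) ⟨(l t).2, by linarith⟩ t ⟨t.2, by linarith⟩
    (by rw [Real.dist_eq]; exact h2.trans_le (min_le_left _ _))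
  simp only [max_eq_right (show e.1 ≤ (t : ℝ) from t.2),
    max_eq_right (show e.1 ≤ (l t : ℝ) from (l t).2), Real.dist_eq] at h5
  calc |z.toFun t - w.toFun t| ≤ |z.toFun t - w.toFun (l t)| + |w.toFun (l t) - w.toFun t| :=
        abs_sub_le _ _ _
    _ ≤ ε := by rw [abs_sub_comm (z.toFun t)]; linarith

/-! ### Continuity of the inverse of the evaluation map at continuous weak flows -/

theorem tendsto_pathRight_comap (E : ℕ → ℝ × ℝ) (φ : CadlagFlow) (k : ℕ) :
    Tendsto (fun ψ : CadlagFlow => ψ.pathRight (E k)) (comap (evalRight E) (𝓝 (evalRight E φ)))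
      (𝓝 (φ.pathRight (E k))) :=
  ((continuous_apply (A := fun k => CadlagPath (E k)) k).tendsto (evalRight E φ)).comp tendsto_comap

/-- Flows `ψ` with `Z^E (ψ)` near `Z^E (φ)` are uniformly close to `φ` over the intervals in a
bounded time window. Only finitely many points of `ℚ²` enter: grid times finer than the modulus of
continuity of `φ`, and grid positions finer than `ε` in one period. -/
theorem eventually_edist_le {E : ℕ → ℝ × ℝ}
    (hE : range E = range (fun q : ℚ × ℚ => ((q.1 : ℝ), (q.2 : ℝ)))) (φ : ContFlow) (n : ℕ)
    {ε : ℝ} (hε : 0 < ε) :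
    ∀ᶠ ψ in comap (evalRight E) (𝓝 (evalRight E φ.toCadlag)), ∀ I : BInterval,
      I.carrier.Nonempty → -(n : ℝ) < sInf I.carrier → sSup I.carrier < n →
        edist (ψ.toFun I) (φ.toCadlag.toFun I) ≤ ENNReal.ofReal (27 * ε) := by
  obtain ⟨δ, hδ, hmod⟩ := φ.exists_modulus (n + 1) hε
  obtain ⟨q, hq⟩ := exists_nat_one_div_lt hδ
  obtain ⟨p, hp⟩ := exists_nat_one_div_lt hε
  -- rational starting points `(j / (q + 1), i / (p + 1))`
  have hgrid : ∀ᶠ ψ in comap (evalRight E) (𝓝 (evalRight E φ.toCadlag)),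
      ∀ j ∈ Finset.Icc (-((n : ℤ) + 1) * (q + 1)) (n * (q + 1)), ∀ i ∈ Finset.range (p + 1),
        ∀ t : ℝ, (j : ℝ) / (q + 1 : ℕ) ≤ t → t ≤ (j : ℝ) / (q + 1 : ℕ) + (2 * n + 1) →
          |(ψ.toFun (BInterval.ioc ((j : ℝ) / (q + 1 : ℕ)) t)).right ((i : ℝ) / (p + 1 : ℕ)) -
            (φ.toCadlag.toFun (BInterval.ioc ((j : ℝ) / (q + 1 : ℕ)) t)).right
              ((i : ℝ) / (p + 1 : ℕ))| ≤ ε := by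
    refine (Filter.eventually_all_finset _).mpr fun j _ =>
      (Filter.eventually_all_finset _).mpr fun i _ => ?_
    obtain ⟨k, hk⟩ : (((j : ℝ) / (q + 1 : ℕ), (i : ℝ) / (p + 1 : ℕ)) : ℝ × ℝ) ∈ range E := by
      rw [hE]
      exact ⟨((j : ℚ) / (q + 1 : ℕ), (i : ℚ) / (p + 1 : ℕ)), by push_cast; rfl⟩
    have h1 := (tendsto_pathRight_comap E φ.toCadlag k).eventually
      ((φ.toCadlag.pathRight (E k)).eventually_close (φ.continuous_pathRight (E k)) (2 * n + 1) hε)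
    rw [hk] at h1
    filter_upwards [h1] with ψ hψ t ht ht'
    exact hψ ⟨t, ht⟩ ht'
  filter_upwards [hgrid] with ψ hψ I hne hI1 hI2
  have hle := csInf_le_csSup hne I.bddBelow I.bddAbove
  set a := sInf I.carrier with ha
  have hq0 : (0 : ℝ) < (q + 1 : ℕ) := by positivity
  -- `j / (q + 1)` is the last grid time before `inf I`
  set j : ℤ := ⌈a * (q + 1 : ℕ)⌉ - 1 with hj
  have hj1 : (j : ℝ) < a * (q + 1 : ℕ) := by
    have := Int.ceil_lt_add_one (a * (q + 1 : ℕ))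
    rw [hj]; push_cast at this ⊢; linarith
  have hj2 : a * (q + 1 : ℕ) ≤ j + 1 := by
    have := Int.le_ceil (a * (q + 1 : ℕ))
    rw [hj]; push_cast at this ⊢; linarith
  have hs1 : (j : ℝ) / (q + 1 : ℕ) < a := (div_lt_iff₀ hq0).mpr hj1
  have hs2 : a ≤ (j : ℝ) / (q + 1 : ℕ) + 1 / (q + 1 : ℕ) := by
    rw [← add_div]; exact (le_div_iff₀ hq0).mpr hj2
  have hq1 : 1 / ((q + 1 : ℕ) : ℝ) ≤ 1 := by
    rw [div_le_one hq0]; push_cast; linarith [(Nat.cast_nonneg q : (0 : ℝ) ≤ q)]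
  have hs3 : -((n : ℝ) + 1) < (j : ℝ) / (q + 1 : ℕ) := by linarith
  have hjmem : j ∈ Finset.Icc (-((n : ℤ) + 1) * (q + 1)) (n * (q + 1)) := by
    rw [Finset.mem_Icc]
    constructor
    · have h1 := ((lt_div_iff₀ hq0).mp hs3).le
      exact_mod_cast h1
    · have h1 : (j : ℝ) ≤ n * (q + 1 : ℕ) :=
        (div_le_iff₀ hq0).mp (by linarith)
      exact_mod_cast h1
  refine CadlagFlow.edist_le_of_ioc ψ φ.toCadlag hne hs1 hε (fun t ht1 ht2 => ?_)
    fun t ht1 ht2 => ?_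
  · refine DegreeOne.edist_le_of_grid (Nat.succ_pos p) (by push_cast; exact hp.le) fun i hi => ?_
    exact hψ j hjmem i (Finset.mem_range.mpr hi) t ht1.le (by linarith)
  · rw [φ.toCadlag_ioc ht1.le]
    push_cast at hs2 ht1 hs3 ⊢
    exact hmod _ _ (by linarith) (by push_cast at hs1; linarith) ht1.le (by linarith)

/-- The evaluation map `Z^E` has a continuous inverse at every continuous weak flow. -/
theorem comap_evalRight_le_nhds {E : ℕ → ℝ × ℝ}
    (hE : range E = range (fun q : ℚ × ℚ => ((q.1 : ℝ), (q.2 : ℝ)))) (φ : ContFlow) :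
    comap (evalRight E) (𝓝 (evalRight E φ.toCadlag)) ≤ 𝓝 φ.toCadlag := by
  rw [← tendsto_id', tendsto_iff_edist_tendsto_0]
  refine tendsto_weightedSum fun n => ENNReal.tendsto_nhds_zero.mpr fun ε hε => ?_
  obtain ⟨r, -, hr0, hr⟩ := ENNReal.lt_iff_exists_real_btwn.mp hε
  have hr0 : 0 < r := ENNReal.ofReal_pos.mp hr0
  filter_upwards [eventually_edist_le hE φ (n + 1) (ε := r / 27) (by linarith)] with ψ hψ
  refine (CadlagFlow.cadlagDist_le n ψ φ.toCadlag _ fun I hne h1 h2 =>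
    hψ I hne (by push_cast; exact h1) (by push_cast; exact h2)).trans ?_
  rw [mul_div_cancel₀ _ (by norm_num)]
  exact hr.le

/-! ### Measurability of the values of a cadlag weak flow -/

theorem BInterval.image_ioc (l : ℝ ≃o ℝ) (a b : ℝ) : (ioc a b).image l = ioc (l a) (l b) := by
  ext x
  simp only [image, ioc, OrderIso.image_Ioc]

theorem BInterval.cutoff_ioc_eq_one {n : ℕ} {a b : ℝ} (hab : a < b) (ha : -(n : ℝ) ≤ a)
    (hb : b ≤ n) : (ioc a b).cutoff n = 1 := by
  unfold cutoff ioc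
  rw [csSup_Ioc hab, csInf_Ioc hab, min_eq_right, max_eq_right zero_le_one]
  linarith [max_le hb (show -a ≤ n by linarith)]

/-- Flows close to `φ` are close to it on a given interval, up to a small change of its end
points. -/
theorem CadlagFlow.eventually_exists_ioc (φ : CadlagFlow) {a b η : ℝ} (hab : a < b) (hη : 0 < η) :
    ∀ᶠ ψ in 𝓝 φ, ∃ a' b', |a' - a| ≤ η ∧ |b' - b| ≤ η ∧ a' < b' ∧
      edist (φ.toFun (BInterval.ioc a b)) (ψ.toFun (BInterval.ioc a' b')) ≤ ENNReal.ofReal η := by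
  obtain ⟨n, hn⟩ := exists_nat_ge (max |a| |b|)
  have hr : 0 < min η 1 := lt_min hη one_pos
  obtain ⟨ρ, hρ, H⟩ := exists_lt_of_weightedSum_lt n (ENNReal.ofReal_pos.mpr hr)
  filter_upwards [Metric.eball_mem_nhds φ hρ] with ψ hψ
  obtain ⟨l, hl⟩ := iInf_lt_iff.mp
    ((cadlagDist_comm_le (n + 1) φ ψ).trans_lt (H (fun n => cadlagDist n ψ φ) hψ))
  have hl1 := (le_sup_left.trans hl.le : distortion l ≤ _)
  have hl2 := (le_sup_right.trans hl.le : warpedDist (n + 1) φ ψ l ≤ _)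
  have hclose : ∀ t, |l t - t| ≤ min η 1 := fun t => by
    have h1 := ((le_iSup (fun t : ℝ => ENNReal.ofReal |l t - t|) t).trans le_sup_left).trans hl1
    rwa [ENNReal.ofReal_le_ofReal_iff hr.le] at h1
  have hlab := l.strictMono hab
  refine ⟨l a, l b, (hclose a).trans (min_le_left _ _), (hclose b).trans (min_le_left _ _),
    hlab, ?_⟩
  have h1 := (le_iSup (fun I : BInterval => circleNorm (fun t =>
    I.cutoff (n + 1) * (φ.toFun I).cross t -
      (I.image l).cutoff (n + 1) * (ψ.toFun (I.image l)).cross t)) (BInterval.ioc a b)).trans hl2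
  have ha := abs_le.mp ((le_max_left _ _).trans hn)
  have hb := abs_le.mp ((le_max_right _ _).trans hn)
  have ha' := abs_le.mp ((hclose a).trans (min_le_right _ _))
  have hb' := abs_le.mp ((hclose b).trans (min_le_right _ _))
  simp only [BInterval.image_ioc] at h1
  rw [BInterval.cutoff_ioc_eq_one hab (by push_cast; linarith) (by push_cast; linarith),
    BInterval.cutoff_ioc_eq_one hlab (by push_cast; linarith) (by push_cast; linarith)] at h1
  simp only [one_mul] at h1
  exact h1.trans (ENNReal.ofReal_le_ofReal (min_le_left _ _))

/-- The set of flows which exceed `c` somewhere on an open box of times and positions just after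
`(s, t, x)`. -/
def exceedSet (s t x δ c : ℝ) : Set CadlagFlow :=
  {φ | ∃ a b y, a ∈ Ioo s (s + δ) ∧ b ∈ Ioo t (t + δ) ∧ y ∈ Ioo x (x + δ) ∧ a < b ∧
    c < (φ.toFun (BInterval.ioc a b)).right y}

theorem isOpen_exceedSet (s t x δ c : ℝ) : IsOpen (exceedSet s t x δ c) := by
  refine isOpen_iff_mem_nhds.mpr ?_
  rintro φ ⟨a, b, y, ha, hb, hy, hab, hc⟩
  obtain ⟨η, hη, hη'⟩ : ∃ η > 0, η < a - s ∧ η < s + δ - a ∧ η < b - t ∧ η < t + δ - b ∧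
      η < x + δ - y ∧ η < (φ.toFun (BInterval.ioc a b)).right y - c := by
    have h : ∀ {u v : ℝ}, u < v → ∀ᶠ η in 𝓝[>] (0 : ℝ), η < v - u := fun huv =>
      (eventually_lt_nhds (sub_pos.mpr huv)).filter_mono nhdsWithin_le_nhds
    obtain ⟨η, h0, h1⟩ := ((eventually_mem_nhdsWithin (a := (0 : ℝ)) (s := Ioi 0)).and
      ((h ha.1).and ((h ha.2).and ((h hb.1).and ((h hb.2).and ((h hy.2).and (h hc))))))).exists
    exact ⟨η, h0, h1⟩
  obtain ⟨h1, h2, h3, h4, h5, h6⟩ := hη'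
  filter_upwards [φ.eventually_exists_ioc hab hη] with ψ ⟨a', b', ha', hb', hab', hd⟩
  have h7 := ((DegreeOne.edist_le_iff hη.le).mp hd y).1
  rw [abs_le] at ha' hb'
  refine ⟨a', b', y + η, ⟨?_, ?_⟩, ⟨?_, ?_⟩, ⟨?_, ?_⟩, hab', ?_⟩ <;>
    linarith [hy.1, ha'.1, ha'.2, hb'.1, hb'.2]

/-- If `φ_{(s,t]}⁺ x ≥ c`, then `φ_{(a,b]}⁺ (x + δ / 2) > c - δ` for `a ↓ s` and `b ↓ t`: the
shift in space makes up for the motion on `(s, a]`. -/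
theorem CadlagFlow.mem_exceedSet (φ : CadlagFlow) {s t x δ c : ℝ} (hst : s < t) (hδ : 0 < δ)
    (hc : c ≤ (φ.toFun (BInterval.ioc s t)).right x) : φ ∈ exceedSet s t x δ (c - δ) := by
  obtain ⟨b, hb, hb'⟩ := ((φ.eventually_close_right t (half_pos hδ)).and
    (Ioo_mem_nhdsGT (show t < t + δ by linarith))).exists
  obtain ⟨a, ha, ha', hat⟩ := ((φ.eventually_close_right s (half_pos hδ)).and
    (inter_mem (Ioo_mem_nhdsGT (show s < s + δ by linarith)) (Ioo_mem_nhdsGT hst))).exists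
  have hab : a < b := hat.2.trans hb'.1
  refine ⟨a, b, x + δ / 2, ha', hb', ⟨by linarith, by linarith⟩, hab, ?_⟩
  have h1 := ((φ.weak_flow _ _ _ (BInterval.isSum_ioc_ioc hst.le hb'.1.le)).close
    (fun y => (hb y).1) (fun y => (hb y).2) x).1
  have h2 := (φ.weak_flow _ _ _ (BInterval.isSum_ioc_ioc ha'.1.le hab.le)).right_le_of_right ha x
  linarith [(abs_le.mp h1).1]

/-- If `φ_{(s,t]}⁺ x < c`, this persists just after `(s, t, x)`, by right continuity of
`φ_{(s,t]}⁺` and because `φ` moves little on `(s, a]` and on `(t, b]`. -/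
theorem CadlagFlow.exists_notMem_exceedSet (φ : CadlagFlow) {s t x c : ℝ} (hst : s < t)
    (hc : (φ.toFun (BInterval.ioc s t)).right x < c) :
    ∃ δ₀ > 0, ∀ δ ≤ δ₀, φ ∉ exceedSet s t x δ (c - δ) := by
  obtain ⟨z, hz, hxz⟩ := ((((φ.toFun (BInterval.ioc s t)).right_continuous x).mono
    Ioi_subset_Ici_self).eventually_lt_const hc |>.and self_mem_nhdsWithin).exists
  set r := z - x with hr
  set g := c - (φ.toFun (BInterval.ioc s t)).right z with hg
  have hr0 : 0 < r := sub_pos.mpr hxz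
  have hg0 : 0 < g := sub_pos.mpr hz
  obtain ⟨b₀, hb₀, hb⟩ := mem_nhdsGT_iff_exists_Ioo_subset.mp
    (φ.eventually_close_right t (half_pos hg0))
  obtain ⟨a₀, ha₀, ha⟩ := mem_nhdsGT_iff_exists_Ioo_subset.mp
    (φ.eventually_close_right s (show 0 < r / 3 by linarith))
  rw [mem_Ioi] at ha₀ hb₀
  refine ⟨min (min (b₀ - t) (a₀ - s)) (min (g / 2) (r / 2)), by
    refine lt_min (lt_min ?_ ?_) (lt_min ?_ ?_) <;> linarith, ?_⟩
  rintro δ hδ ⟨a, b, y, hab, hbb, hy, hlt, h⟩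
  simp only [le_min_iff] at hδ
  obtain ⟨⟨hδ1, hδ2⟩, hδ3, hδ4⟩ := hδ
  have hb' := hb (show b ∈ Ioo t b₀ from ⟨hbb.1, by linarith [hbb.2]⟩)
  have ha' := ha (show a ∈ Ioo s a₀ from ⟨hab.1, by linarith [hab.2]⟩)
  have h1 := ((φ.weak_flow _ _ _ (BInterval.isSum_ioc_ioc hst.le hbb.1.le)).close
    (fun y => (hb' y).1) (fun y => (hb' y).2) z).1
  have h2 := (φ.weak_flow _ _ _ (BInterval.isSum_ioc_ioc hab.1.le hlt.le)).left_le_of_right ha' z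
  have h3 := (φ.toFun (BInterval.ioc a b)).right_le_left
    (show y < z - r / 3 by linarith [hy.2])
  have h4 := (φ.toFun (BInterval.ioc s b)).left_le_right z
  linarith [(abs_le.mp h1).2]

/-- Each value `φ_{(s,t]}⁺ x` is a Borel function of the flow `φ`: its superlevel sets are
countable intersections of open sets. -/
theorem measurable_eval {s t : ℝ} (hst : s ≤ t) (x : ℝ) :
    Measurable fun φ : CadlagFlow => (φ.toFun (BInterval.ioc s t)).right x := by
  rcases hst.eq_or_lt with rfl | hst
  · simp only [CadlagFlow.map_ioc_self]
    exact measurable_const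
  refine measurable_of_Ici fun c => ?_
  have h : (fun φ : CadlagFlow => (φ.toFun (BInterval.ioc s t)).right x) ⁻¹' Ici c =
      ⋂ k : ℕ, exceedSet s t x (1 / ((k : ℝ) + 1)) (c - 1 / ((k : ℝ) + 1)) := by
    ext φ
    rw [mem_iInter]
    refine ⟨fun h k => φ.mem_exceedSet hst Nat.one_div_pos_of_nat h, fun h => ?_⟩
    by_contra hc
    obtain ⟨δ, hδ, H⟩ := φ.exists_notMem_exceedSet hst (not_le.mp hc)
    obtain ⟨k, hk⟩ := exists_nat_one_div_lt hδ
    exact H _ hk.le (h k)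
  rw [h]
  exact MeasurableSet.iInter fun k => (isOpen_exceedSet _ _ _ _ _).measurableSet

/-! ### Regularity of cadlag functions on compact intervals -/

/-- A function which is right continuous at `p`, with a limit `y` from the left, is close to `y`
just before `p` and close to its value at `p` just after. -/
theorem exists_local_oscillation {Z : ℝ → ℝ} {p y : ℝ} (hR : ContinuousWithinAt Z (Ici p) p)
    (hL : Tendsto Z (𝓝[<] p) (𝓝 y)) {ε : ℝ} (hε : 0 < ε) :
    ∃ r > 0, (∀ u ∈ Ioo (p - r) p, |Z u - y| ≤ ε) ∧ ∀ u ∈ Ico p (p + r), |Z u - Z p| ≤ ε := by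
  obtain ⟨a, ha, hL⟩ := mem_nhdsLT_iff_exists_Ioo_subset.mp
    (Metric.tendsto_nhds.mp hL ε hε)
  obtain ⟨b, hb, hR⟩ := mem_nhdsGE_iff_exists_Ico_subset.mp
    (Metric.tendsto_nhds.mp hR ε hε)
  rw [mem_Iio] at ha
  rw [mem_Ioi] at hb
  refine ⟨min (p - a) (b - p), lt_min (sub_pos.mpr ha) (sub_pos.mpr hb), fun u hu => ?_,
    fun u hu => ?_⟩
  · exact (hL ⟨by linarith [hu.1, min_le_left (p - a) (b - p)], hu.2⟩).le
  · exact (hR ⟨hu.1, by linarith [hu.2, min_le_right (p - a) (b - p)]⟩).le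

/-- A cadlag function is bounded on compact intervals, and there are finitely many points such
that it oscillates by at most `ε` over intervals `(u, v]` containing none of them. -/
theorem exists_finset_oscillation {Z : ℝ → ℝ} (hR : ∀ t, ContinuousWithinAt Z (Ici t) t)
    (hL : ∀ t, ∃ y, Tendsto Z (𝓝[<] t) (𝓝 y)) (a b : ℝ) {ε : ℝ} (hε : 0 < ε) :
    ∃ (P : Finset ℝ) (B : ℝ), (∀ u ∈ Icc a b, |Z u| ≤ B) ∧
      ∀ u v, a ≤ u → u ≤ v → v ≤ b → (∀ p ∈ P, p ≤ u ↔ p ≤ v) → |Z u - Z v| ≤ ε := by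
  choose y hL using hL
  choose r hr hrl hrr using fun p => exists_local_oscillation (hR p) (hL p) (half_pos hε)
  obtain ⟨F, -, hF⟩ := (isCompact_Icc (a := a) (b := b)).elim_nhds_subcover
    (fun p => Ioo (p - r p) (p + r p))
    (fun p _ => Ioo_mem_nhds (by linarith [hr p]) (by linarith [hr p]))
  have hcover : ∀ u ∈ Icc a b, ∃ p ∈ F, u ∈ Ioo (p - r p) (p + r p) := fun u hu => by
    simpa only [mem_iUnion, exists_prop] using hF hu
  obtain ⟨B, hB⟩ := (F.image fun p => |y p| + |Z p| + ε).exists_le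
  refine ⟨F ∪ F.image (fun p => p + r p), B, fun u hu => ?_, fun u v hau huv hvb h => ?_⟩
  · obtain ⟨p, hpF, hp⟩ := hcover u hu
    refine le_trans ?_ (hB _ (Finset.mem_image_of_mem _ hpF))
    rcases lt_or_ge u p with hup | hup
    · have h1 := hrl p u ⟨hp.1, hup⟩
      have h2 := abs_sub_abs_le_abs_sub (Z u) (y p)
      linarith [abs_nonneg (Z p)]
    · have h1 := hrr p u ⟨hup, hp.2⟩
      have h2 := abs_sub_abs_le_abs_sub (Z u) (Z p)
      linarith [abs_nonneg (y p)]
  · obtain ⟨p, hpF, hp⟩ := hcover u ⟨hau, huv.trans hvb⟩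
    have h1 := h p (Finset.mem_union_left _ hpF)
    have h2 := h (p + r p) (Finset.mem_union_right _ (Finset.mem_image_of_mem _ hpF))
    have hv : v < p + r p := not_le.mp fun hc => absurd (h2.mpr hc) (not_le.mpr hp.2)
    rcases lt_or_ge u p with hup | hup
    · have hvp : v < p := not_le.mp fun hc => absurd (h1.mpr hc) (not_le.mpr hup)
      have h3 := hrl p u ⟨hp.1, hup⟩
      have h4 := hrl p v ⟨hp.1.trans_le huv, hvp⟩
      rw [abs_sub_comm] at h4
      linarith [abs_sub_le (Z u) (y p) (Z v)]
    · have h3 := hrr p u ⟨hup, hp.2⟩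
      have h4 := hrr p v ⟨hup.trans huv, hv⟩
      rw [abs_sub_comm] at h4
      linarith [abs_sub_le (Z u) (Z p) (Z v)]

namespace CadlagPath

/-- The path `z` on `[s, ∞)`, extended to `ℝ` by its initial value. -/
noncomputable def extend {e : ℝ × ℝ} (z : CadlagPath e) (u : ℝ) : ℝ :=
  z.toFun ⟨max e.1 u, mem_Ici.mpr (le_max_left _ _)⟩

theorem extend_coe {e : ℝ × ℝ} (z : CadlagPath e) (t : Ici e.1) : z.extend t = z.toFun t := by
  unfold extend
  congr 1
  exact Subtype.ext (max_eq_right t.2)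

theorem extend_start {e : ℝ × ℝ} (z : CadlagPath e) : z.extend e.1 = e.2 :=
  (z.extend_coe ⟨e.1, self_mem_Ici⟩).trans z.start

theorem continuous_clamp (s : ℝ) :
    Continuous fun u : ℝ => (⟨max s u, mem_Ici.mpr (le_max_left _ _)⟩ : Ici s) :=
  Continuous.subtype_mk (continuous_const.max continuous_id) _

theorem extend_right_continuous {e : ℝ × ℝ} (z : CadlagPath e) (t : ℝ) :
    ContinuousWithinAt z.extend (Ici t) t := by
  refine (z.right_continuous ⟨max e.1 t, mem_Ici.mpr (le_max_left _ _)⟩).comp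
    (t := Ici _) (continuous_clamp e.1).continuousWithinAt fun u hu => ?_
  exact max_le_max_left e.1 (show t ≤ u from hu)

theorem extend_left_limit {e : ℝ × ℝ} (z : CadlagPath e) (t : ℝ) :
    ∃ y, Tendsto z.extend (𝓝[<] t) (𝓝 y) := by
  rcases le_or_gt t e.1 with h | h
  · refine ⟨z.extend t, tendsto_const_nhds.congr' (eventually_nhdsWithin_of_forall fun u hu => ?_)⟩
    unfold extend
    congr 2
    rw [max_eq_left h, max_eq_left (le_of_lt (lt_of_lt_of_le hu h))]
  · obtain ⟨y, hy⟩ := z.left_limit ⟨max e.1 t, mem_Ici.mpr (le_max_left _ _)⟩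
    refine ⟨y, hy.comp (tendsto_nhdsWithin_iff.mpr
      ⟨((continuous_clamp e.1).tendsto t).mono_left nhdsWithin_le_nhds, ?_⟩)⟩
    filter_upwards [self_mem_nhdsWithin] with u hu
    have : max e.1 u < max e.1 t := by
      rw [max_eq_right h.le]
      exact max_lt h hu
    exact this

/-! ### Approximation of cadlag paths by step paths -/

/-- The path started from `e = (s, x)` which takes the value `a j` on
`[s + j / (m + 1), s + (j + 1) / (m + 1))` for `j ≥ 1`, and the value `x` for `j = 0`. -/
noncomputable def ofSteps (e : ℝ × ℝ) (m : ℕ) (a : ℤ → ℝ) : CadlagPath e where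
  toFun t := Function.update a 0 e.2 ⌊((t : ℝ) - e.1) * ((m : ℝ) + 1)⌋
  start := by simp
  right_continuous t := by
    have hm : (0 : ℝ) < (m : ℝ) + 1 := by positivity
    have h1 : Tendsto (fun u : Ici e.1 => ((u : ℝ) - e.1) * ((m : ℝ) + 1)) (𝓝[≥] t)
        (𝓝[≥] (((t : ℝ) - e.1) * ((m : ℝ) + 1))) := by
      refine tendsto_nhdsWithin_iff.mpr ⟨?_, eventually_nhdsWithin_of_forall fun u hu => ?_⟩
      · have h : Continuous fun u : Ici e.1 => ((u : ℝ) - e.1) * ((m : ℝ) + 1) := by fun_prop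
        exact (h.tendsto t).mono_left nhdsWithin_le_nhds
      · exact mul_le_mul_of_nonneg_right (sub_le_sub_right (Subtype.coe_le_coe.mpr hu) _) hm.le
    exact ((tendsto_pure_pure (Function.update a 0 e.2) _).comp
      ((tendsto_floor_right_pure_floor _).comp h1)).mono_right (pure_le_nhds _)
  left_limit t := by
    have hm : (0 : ℝ) < (m : ℝ) + 1 := by positivity
    have h1 : Tendsto (fun u : Ici e.1 => ((u : ℝ) - e.1) * ((m : ℝ) + 1)) (𝓝[<] t)
        (𝓝[<] (((t : ℝ) - e.1) * ((m : ℝ) + 1))) := by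
      refine tendsto_nhdsWithin_iff.mpr ⟨?_, eventually_nhdsWithin_of_forall fun u hu => ?_⟩
      · have h : Continuous fun u : Ici e.1 => ((u : ℝ) - e.1) * ((m : ℝ) + 1) := by fun_prop
        exact (h.tendsto t).mono_left nhdsWithin_le_nhds
      · exact mul_lt_mul_of_pos_right (sub_lt_sub_right (Subtype.coe_lt_coe.mpr hu) _) hm
    exact ⟨_, ((tendsto_pure_pure (Function.update a 0 e.2) _).comp
      ((tendsto_floor_left_pure_ceil_sub_one _).comp h1)).mono_right (pure_le_nhds _)⟩

end CadlagPath

theorem timeCutoff_nonneg {s : ℝ} (n : ℕ) (t : Ici s) : 0 ≤ timeCutoff n t := le_max_left _ _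

theorem timeCutoff_le_one {s : ℝ} (n : ℕ) (t : Ici s) : timeCutoff n t ≤ 1 :=
  max_le zero_le_one (min_le_right _ _)

theorem timeCutoff_eq_zero {s : ℝ} {n : ℕ} {t : Ici s} (h : s + n + 1 ≤ t) :
    timeCutoff n t = 0 :=
  max_eq_left ((min_le_left _ _).trans (by linarith))

theorem abs_timeCutoff_sub_le {s : ℝ} (n : ℕ) (t u : Ici s) :
    |timeCutoff n t - timeCutoff n u| ≤ |(t : ℝ) - u| := by
  unfold timeCutoff
  refine (abs_max_sub_max_le_max _ _ _ _).trans (max_le (by simp) ?_)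
  refine (abs_min_sub_min_le_max _ _ _ _).trans (max_le ?_ (by simp))
  rw [abs_sub_comm (t : ℝ)]
  exact le_of_eq (by congr 1; ring)

namespace CadlagPath

theorem continuous_ofSteps (e : ℝ × ℝ) (m : ℕ) : Continuous (ofSteps e m) := by
  refine continuous_iff_continuousAt.mpr fun a => ?_
  rw [ContinuousAt, tendsto_iff_edist_tendsto_0]
  refine tendsto_weightedSum fun n => ENNReal.tendsto_nhds_zero.mpr fun ε hε => ?_
  have hev : ∀ᶠ b in 𝓝 a, ∀ j ∈ Finset.Icc (0 : ℤ) ((n + 1) * (m + 1)), edist (b j) (a j) ≤ ε := by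
    refine (Filter.eventually_all_finset _).mpr fun j _ => ?_
    have h1 := tendsto_iff_edist_tendsto_0.mp ((continuous_apply (A := fun _ : ℤ => ℝ) j).tendsto a)
    exact ENNReal.tendsto_nhds_zero.mp h1 ε hε
  filter_upwards [hev] with b hb
  refine iInf_le_of_le (OrderIso.refl _) ?_
  rw [logSlope_refl, zero_add]
  refine iSup_le fun t => ?_
  rw [OrderIso.refl_apply]
  rcases le_or_gt (e.1 + n + 1) t with h | h
  · simp [timeCutoff_eq_zero h]
  have hts : e.1 ≤ t := t.2
  have hval : edist ((ofSteps e m b).toFun t) ((ofSteps e m a).toFun t) ≤ ε := by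
    simp only [ofSteps]
    rcases eq_or_ne ⌊((t : ℝ) - e.1) * ((m : ℝ) + 1)⌋ 0 with h0 | h0
    · simp [h0]
    · rw [Function.update_of_ne h0, Function.update_of_ne h0]
      refine hb _ (Finset.mem_Icc.mpr ⟨Int.floor_nonneg.mpr (mul_nonneg (by linarith)
        (by positivity)), ?_⟩)
      have h1 : ((t : ℝ) - e.1) * ((m : ℝ) + 1) ≤ ((n : ℝ) + 1) * ((m : ℝ) + 1) :=
        mul_le_mul_of_nonneg_right (by linarith) (by positivity)
      exact_mod_cast (Int.floor_le _).trans h1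
  refine le_trans ?_ hval
  rw [edist_eq_enorm_sub, edist_eq_enorm_sub, ← mul_sub, Real.enorm_eq_ofReal_abs,
    Real.enorm_eq_ofReal_abs, abs_mul, abs_of_nonneg (timeCutoff_nonneg n t)]
  exact ENNReal.ofReal_le_ofReal
    (mul_le_of_le_one_left (abs_nonneg _) (timeCutoff_le_one n t))

/-- The step path which samples `z` at the times `s + j / (m + 1)`. -/
noncomputable def sample {e : ℝ × ℝ} (m : ℕ) (z : CadlagPath e) : CadlagPath e :=
  ofSteps e m fun j => z.extend (e.1 + j / ((m : ℝ) + 1))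

theorem sample_apply {e : ℝ × ℝ} (m : ℕ) (z : CadlagPath e) (t : Ici e.1) :
    (z.sample m).toFun t =
      z.extend (e.1 + ⌊((t : ℝ) - e.1) * ((m : ℝ) + 1)⌋ / ((m : ℝ) + 1)) := by
  simp only [sample, ofSteps]
  rcases eq_or_ne ⌊((t : ℝ) - e.1) * ((m : ℝ) + 1)⌋ 0 with h0 | h0
  · simp [h0, extend_start]
  · rw [Function.update_of_ne h0]

end CadlagPath

/-- A non-negative Lipschitz function `h` with a small constant `K` which vanishes at `s` gives
the time change `t ↦ t + h t` of `[s, ∞)`, whose slopes are close to one. -/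
theorem exists_timeChange {s : ℝ} {h : ℝ → ℝ} {K : ℝ} (hK0 : 0 ≤ K) (hK : K ≤ 1 / 2)
    (hs : h s = 0) (h0 : ∀ t, 0 ≤ h t) (hLip : ∀ t u, |h t - h u| ≤ K * |t - u|) :
    ∃ l : Ici s ≃o Ici s, (∀ t, (l t : ℝ) = t + h t) ∧ logSlope l ≤ ENNReal.ofReal (2 * K) := by
  have hmem : ∀ t : Ici s, (t : ℝ) + h t ∈ Ici s := fun t =>
    (show s ≤ t from t.2).trans (le_add_of_nonneg_right (h0 t))
  have hslope : ∀ r t : ℝ, r < t → |h t - h r| ≤ K * (t - r) := fun r t hrt => by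
    simpa [abs_of_pos (sub_pos.mpr hrt)] using hLip t r
  have hmono : StrictMono fun t : Ici s => (⟨t + h t, hmem t⟩ : Ici s) := by
    intro r t hrt
    have hrt' : (r : ℝ) < t := hrt
    have h1 := (abs_le.mp (hslope r t hrt')).1
    have h2 : (r : ℝ) + h r < t + h t := by nlinarith
    exact h2
  have hcont : Continuous h := by
    refine (LipschitzWith.of_dist_le_mul (K := ⟨K, hK0⟩) fun t u => ?_).continuous
    rw [Real.dist_eq, Real.dist_eq]
    exact hLip t u
  have hsurj : Function.Surjective fun t : Ici s => (⟨t + h t, hmem t⟩ : Ici s) := by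
    rintro ⟨u, hu⟩
    have hu' : s ≤ u := hu
    obtain ⟨t, ht, htu⟩ := intermediate_value_Icc hu'
      ((continuous_id.add hcont).continuousOn (s := Icc s u))
      (show u ∈ Icc (s + h s) (u + h u) from ⟨by rw [hs]; linarith, by linarith [h0 u]⟩)
    exact ⟨⟨t, ht.1⟩, Subtype.ext htu⟩
  refine ⟨hmono.orderIsoOfSurjective _ hsurj, fun t => rfl, ?_⟩
  refine iSup_le fun r => iSup_le fun t => iSup_le fun hrt => ENNReal.ofReal_le_ofReal ?_
  have hpos : (0 : ℝ) < t - r := sub_pos.mpr hrt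
  have h1 := abs_le.mp (hslope r t hrt)
  change |Real.log (((t + h t) - (r + h r)) / ((t : ℝ) - r))| ≤ 2 * K
  have hl : 1 - K ≤ ((t + h t) - (r + h r)) / ((t : ℝ) - r) := by
    rw [le_div_iff₀ hpos]; linarith [h1.1]
  have hu : ((t + h t) - (r + h r)) / ((t : ℝ) - r) ≤ 1 + K := by
    rw [div_le_iff₀ hpos]; linarith [h1.2]
  set ρ := ((t + h t) - (r + h r)) / ((t : ℝ) - r)
  have hρ : 0 < ρ := by linarith
  refine abs_le.mpr ⟨?_, by linarith [Real.log_le_sub_one_of_pos hρ]⟩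
  have h2 := Real.one_sub_inv_le_log_of_pos hρ
  have h3 : ρ⁻¹ ≤ 1 + 2 * K := by
    rw [inv_le_iff_one_le_mul₀ hρ]
    nlinarith
  linarith

/-- Finitely many times can be moved up to the grid of mesh `1 / (m + 1)` by a time change with
slopes close to one, as soon as the mesh is small compared with the gaps between these times. The
displacement is a Lipschitz extension of its prescribed values. -/
theorem exists_displacement {s K : ℝ} {m : ℕ} {Q : Finset ℝ} (hK0 : 0 ≤ K) (hsQ : s ∈ Q)
    (hQ : ∀ p ∈ Q, ∀ q ∈ Q, p ≠ q → 1 / ((m : ℝ) + 1) ≤ K * |p - q|) :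
    ∃ h : ℝ → ℝ, (∀ t, 0 ≤ h t ∧ h t ≤ 1 / ((m : ℝ) + 1)) ∧ h s = 0 ∧
      (∀ t u, |h t - h u| ≤ K * |t - u|) ∧
      ∀ p ∈ Q, p + h p = s + ⌈(p - s) * ((m : ℝ) + 1)⌉ / ((m : ℝ) + 1) := by
  have hm : (0 : ℝ) < (m : ℝ) + 1 := by positivity
  set f : ℝ → ℝ := fun p => s + ⌈(p - s) * ((m : ℝ) + 1)⌉ / ((m : ℝ) + 1) - p with hf
  have hf0 : ∀ p, 0 ≤ f p := fun p => by
    have h1 : p - s ≤ ⌈(p - s) * ((m : ℝ) + 1)⌉ / ((m : ℝ) + 1) :=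
      (le_div_iff₀ hm).mpr (Int.le_ceil _)
    simp only [hf]; linarith
  have hf1 : ∀ p, f p ≤ 1 / ((m : ℝ) + 1) := fun p => by
    have h1 : (⌈(p - s) * ((m : ℝ) + 1)⌉ : ℝ) / ((m : ℝ) + 1) ≤ (p - s) + 1 / ((m : ℝ) + 1) := by
      rw [div_le_iff₀ hm, add_mul, one_div, inv_mul_cancel₀ hm.ne']
      exact (Int.ceil_lt_add_one _).le
    simp only [hf]; linarith
  have hLipQ : LipschitzOnWith ⟨K, hK0⟩ f (Q : Set ℝ) := by
    refine LipschitzOnWith.of_dist_le_mul fun p hp q hq => ?_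
    rw [Real.dist_eq, Real.dist_eq]
    rcases eq_or_ne p q with rfl | hpq
    · simp
    · refine le_trans (abs_le.mpr ⟨?_, ?_⟩) (hQ p hp q hq hpq) <;>
        linarith [hf0 p, hf0 q, hf1 p, hf1 q]
  obtain ⟨g, hg, hgf⟩ := hLipQ.extend_real
  have hon : ∀ p ∈ Q, max 0 (min (g p) (1 / ((m : ℝ) + 1))) = f p := fun p hp => by
    rw [← hgf hp, min_eq_left (hf1 p), max_eq_right (hf0 p)]
  refine ⟨fun t => max 0 (min (g t) (1 / ((m : ℝ) + 1))), fun t => ⟨le_max_left _ _,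
    max_le (by positivity) (min_le_right _ _)⟩, ?_, fun t u => ?_, fun p hp => ?_⟩
  · simp only [hon s hsQ, hf]
    simp
  · have h1 := hg.dist_le_mul t u
    rw [Real.dist_eq, Real.dist_eq] at h1
    refine le_trans ?_ h1
    refine (abs_max_sub_max_le_max _ _ _ _).trans (max_le (by simp) ?_)
    exact (abs_min_sub_min_le_max _ _ _ _).trans (max_le le_rfl (by simp))
  · simp only [hon p hp, hf]
    ring

namespace CadlagPath

/-- The sampled path is close to `z` after a time change `l` which moves the points of `P`, between
which `z` oscillates by at most `ε`, to grid points. Then `l t` and the grid time before it lie in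
the same piece as `t`, and the cutoff changes by at most the mesh. -/
theorem pathDist_sample_le {e : ℝ × ℝ} (z : CadlagPath e) (n m : ℕ) {ε B : ℝ} {P : Finset ℝ}
    (hε : 0 < ε) (hε2 : ε ≤ 1 / 2)
    (hB : ∀ u ∈ Icc e.1 (e.1 + n + 3), |z.extend u| ≤ B)
    (hP : ∀ u v, e.1 ≤ u → u ≤ v → v ≤ e.1 + n + 3 → (∀ p ∈ P, p ≤ u ↔ p ≤ v) →
      |z.extend u - z.extend v| ≤ ε)
    (hQ : ∀ p ∈ insert e.1 P, ∀ q ∈ insert e.1 P, p ≠ q → 1 / ((m : ℝ) + 1) ≤ ε * |p - q|)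
    (hmB : 1 / ((m : ℝ) + 1) * B ≤ ε) :
    pathDist n (z.sample m) z ≤ ENNReal.ofReal (4 * ε) := by
  obtain ⟨h, h01, hs, hLip, hgrid⟩ := exists_displacement hε.le (Finset.mem_insert_self e.1 P) hQ
  obtain ⟨l, hl, hslope⟩ := exists_timeChange hε.le hε2 hs (fun t => (h01 t).1) hLip
  have hm : (0 : ℝ) < (m : ℝ) + 1 := by positivity
  have hm1 : 1 / ((m : ℝ) + 1) ≤ 1 := by
    rw [div_le_one hm]; linarith [(Nat.cast_nonneg m : (0 : ℝ) ≤ m)]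
  have hB0 : 0 ≤ B := (abs_nonneg _).trans (hB e.1 ⟨le_rfl, by
    linarith [(Nat.cast_nonneg n : (0 : ℝ) ≤ n)]⟩)
  refine iInf_le_of_le l ?_
  rw [show 4 * ε = 2 * ε + 2 * ε by ring, ENNReal.ofReal_add (by linarith) (by linarith)]
  refine add_le_add hslope (iSup_le fun t => ?_)
  have hts : e.1 ≤ t := t.2
  rcases le_or_gt (e.1 + n + 2) t with hn | hn
  · have h1 := (h01 t).1
    rw [timeCutoff_eq_zero (t := t) (by linarith), timeCutoff_eq_zero (by rw [hl]; linarith)]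
    simp
  rw [sample_apply, ← z.extend_coe t]
  set τ := e.1 + ⌊((l t : ℝ) - e.1) * ((m : ℝ) + 1)⌋ / ((m : ℝ) + 1) with hτ
  have hτl : τ ≤ l t := by
    have h1 : (⌊((l t : ℝ) - e.1) * ((m : ℝ) + 1)⌋ : ℝ) / ((m : ℝ) + 1) ≤ l t - e.1 :=
      (div_le_iff₀ hm).mpr (Int.floor_le _)
    linarith
  have hshift : ∀ {u v : ℝ}, u < v → u + h u < v + h v := fun {u v} huv => by
    have h1 := abs_le.mp (hLip v u)
    rw [abs_of_pos (sub_pos.mpr huv)] at h1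
    nlinarith [h1.1]
  -- `l` moves the points of `P` to grid points, so `t` and `τ` lie on the same side of them
  have hside : ∀ p ∈ insert e.1 P, (p ≤ t ↔ p ≤ τ) := by
    intro p hp
    have hgp := hgrid p hp
    have hpp := (h01 p).1
    constructor
    · intro hpt
      have h1 : p + h p ≤ l t := by
        rw [hl]
        rcases hpt.eq_or_lt with h | h
        · rw [h]
        · exact (hshift h).le
      have h2 : (⌈(p - e.1) * ((m : ℝ) + 1)⌉ : ℝ) ≤ (l t - e.1) * ((m : ℝ) + 1) := by
        rw [← div_le_iff₀ hm]; linarith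
      have h3 : (⌈(p - e.1) * ((m : ℝ) + 1)⌉ : ℝ) ≤ ⌊((l t : ℝ) - e.1) * ((m : ℝ) + 1)⌋ :=
        Int.cast_le.mpr (Int.le_floor.mpr h2)
      have h4 := div_le_div_of_nonneg_right h3 hm.le
      linarith
    · intro hpτ
      have h2 : (p - e.1) * ((m : ℝ) + 1) ≤ ⌊((l t : ℝ) - e.1) * ((m : ℝ) + 1)⌋ := by
        rw [← le_div_iff₀ hm]; linarith
      have h3 : (⌈(p - e.1) * ((m : ℝ) + 1)⌉ : ℝ) ≤ ⌊((l t : ℝ) - e.1) * ((m : ℝ) + 1)⌋ :=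
        Int.cast_le.mpr (Int.ceil_le.mpr h2)
      have h4 := div_le_div_of_nonneg_right h3 hm.le
      by_contra hc
      have h5 := hshift (not_le.mp hc)
      have h6 := hl t
      linarith
  have hsτ : e.1 ≤ τ := (hside e.1 (Finset.mem_insert_self _ _)).mp hts
  have hlt : (l t : ℝ) ≤ e.1 + n + 3 := by
    rw [hl]; linarith [(h01 t).2]
  have hosc : |z.extend τ - z.extend t| ≤ ε := by
    rcases le_total τ t with hle | hle
    · exact hP τ t hsτ hle (by linarith) fun p hp =>
        (hside p (Finset.mem_insert_of_mem hp)).symm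
    · rw [abs_sub_comm]
      exact hP t τ hts hle (by linarith) fun p hp => hside p (Finset.mem_insert_of_mem hp)
  have hcut : |timeCutoff n (l t) - timeCutoff n t| ≤ 1 / ((m : ℝ) + 1) := by
    refine (abs_timeCutoff_sub_le n (l t) t).trans ?_
    rw [hl, add_sub_cancel_left, abs_of_nonneg (h01 t).1]
    exact (h01 t).2
  rw [edist_dist, Real.dist_eq]
  refine ENNReal.ofReal_le_ofReal ?_
  calc |timeCutoff n (l t) * z.extend τ - timeCutoff n t * z.extend t|
      = |(timeCutoff n (l t) - timeCutoff n t) * z.extend τ +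
          timeCutoff n t * (z.extend τ - z.extend t)| := by congr 1; ring
    _ ≤ 1 / ((m : ℝ) + 1) * B + 1 * ε := by
        refine (abs_add_le _ _).trans (add_le_add ?_ ?_)
        · rw [abs_mul]
          exact mul_le_mul hcut (hB τ ⟨hsτ, hτl.trans hlt⟩) (abs_nonneg _) (by positivity)
        · rw [abs_mul, abs_of_nonneg (timeCutoff_nonneg n t)]
          exact mul_le_mul (timeCutoff_le_one n t) hosc (abs_nonneg _) zero_le_one
    _ ≤ 2 * ε := by linarith

/-- The step paths sampled from a cadlag path on finer and finer grids converge to it. -/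
theorem tendsto_sample {e : ℝ × ℝ} (z : CadlagPath e) :
    Tendsto (fun m => z.sample m) atTop (𝓝 z) := by
  rw [tendsto_iff_edist_tendsto_0]
  refine tendsto_weightedSum fun n => ENNReal.tendsto_nhds_zero.mpr fun r hr => ?_
  obtain ⟨c, -, hc0, hc⟩ := ENNReal.lt_iff_exists_real_btwn.mp hr
  have hc0 : 0 < c := ENNReal.ofReal_pos.mp hc0
  set ε := min (c / 4) (1 / 2) with hεdef
  have hε : 0 < ε := lt_min (by linarith) (by norm_num)
  obtain ⟨P, B, hB, hP⟩ := exists_finset_oscillation z.extend_right_continuous z.extend_left_limit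
    e.1 (e.1 + n + 3) hε
  have hmesh := tendsto_one_div_add_atTop_nhds_zero_nat (𝕜 := ℝ)
  have h1 : ∀ᶠ m : ℕ in atTop, ∀ p ∈ insert e.1 P, ∀ q ∈ insert e.1 P, p ≠ q →
      1 / ((m : ℝ) + 1) ≤ ε * |p - q| := by
    refine (Filter.eventually_all_finset _).mpr fun p _ =>
      (Filter.eventually_all_finset _).mpr fun q _ => ?_
    rcases eq_or_ne p q with h | h
    · exact Eventually.of_forall fun _ hne => absurd h hne
    · filter_upwards [hmesh.eventually_lt_const
        (mul_pos hε (abs_pos.mpr (sub_ne_zero.mpr h)))] with m hm _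
      exact hm.le
  have h2 : ∀ᶠ m : ℕ in atTop, 1 / ((m : ℝ) + 1) * B ≤ ε := by
    have h3 := hmesh.mul_const B
    rw [zero_mul] at h3
    exact (h3.eventually_lt_const hε).mono fun _ h => h.le
  filter_upwards [h1, h2] with m hm1 hm2
  refine (z.pathDist_sample_le n m hε (min_le_right _ _) hB hP hm1 hm2).trans
    ((ENNReal.ofReal_le_ofReal ?_).trans hc.le)
  linarith [min_le_left (c / 4) (1 / 2)]

end CadlagPath

/-! ### Measurability of the evaluation map -/

instance (E : ℕ → ℝ × ℝ) : TopologicalSpace.PseudoMetrizableSpace (PathSeq E) :=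
  inferInstanceAs (TopologicalSpace.PseudoMetrizableSpace ((k : ℕ) → CadlagPath (E k)))

/-- The sequence of step paths `(z_k)` in `D_E` sampled from the sequence of paths
`Z^E (φ)`. -/
noncomputable def sampleRight (E : ℕ → ℝ × ℝ) (m : ℕ) (φ : CadlagFlow) : PathSeq E :=
  fun k => (φ.pathRight (E k)).sample m

/-- The sequence of step paths in `D_E` with the values `a k j`. -/
noncomputable def stepSeq (E : ℕ → ℝ × ℝ) (m : ℕ) (a : ℕ → ℤ → ℝ) : PathSeq E :=
  fun k => CadlagPath.ofSteps (E k) m (a k)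

/-- Sampling on a grid factors through countably many values of the flow. -/
theorem measurable_sampleRight (E : ℕ → ℝ × ℝ) (m : ℕ) :
    Measurable (sampleRight E m) := by
  have h1 : Continuous (stepSeq E m) :=
    continuous_pi (A := fun k => CadlagPath (E k)) fun k =>
      (CadlagPath.continuous_ofSteps (E k) m).comp (continuous_apply k)
  have h2 : Measurable fun (φ : CadlagFlow) (k : ℕ) (j : ℤ) =>
      (φ.pathRight (E k)).extend ((E k).1 + j / ((m : ℝ) + 1)) :=
    measurable_pi_iff.mpr fun k => measurable_pi_iff.mpr fun j =>
      measurable_eval (le_max_left _ _) _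
  exact h1.measurable.comp h2

/-- The evaluation map is the pointwise limit of the measurable maps `sampleRight`. Since `D_E` is
pseudometrizable this suffices, and no separability of the Skorokhod space is needed. -/
theorem measurable_evalRight (E : ℕ → ℝ × ℝ) : Measurable (evalRight E) := by
  refine measurable_of_tendsto_metrizable (measurable_sampleRight E) ?_
  refine tendsto_pi_nhds.mpr fun φ => ?_
  exact (tendsto_pi_nhds (A := fun k => CadlagPath (E k))).mpr fun k =>
    (φ.pathRight (E k)).tendsto_sample

/-! ### Transfer of weak convergence -/

/-- Portmanteau argument: for `F` closed, `μ_n (F)` is at most the mass of the closure of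
`Z^E (F)` under the image of `μ_n`, and a continuous flow which `Z^E` maps into this closure lies
in `F`, because `Z^E` has a continuous inverse at continuous flows. -/
theorem tendsto_of_tendsto_map_evalRight {E : ℕ → ℝ × ℝ}
    (hE : range E = range (fun q : ℚ × ℚ => ((q.1 : ℝ), (q.2 : ℝ))))
    (μs : ℕ → ProbabilityMeasure CadlagFlow) (μ : ProbabilityMeasure ContFlow)
    (h : Tendsto (fun n => (μs n).map (measurable_evalRight E).aemeasurable) atTop
      (𝓝 ((onCadlag μ).map (measurable_evalRight E).aemeasurable))) :
    Tendsto μs atTop (𝓝 (onCadlag μ)) := by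
  refine tendsto_of_forall_isClosed_limsup_le' fun F hF => ?_
  have hK : IsClosed (closure (evalRight E '' F)) := isClosed_closure
  have hmeas := measurable_evalRight E hK.measurableSet
  have h1 := ProbabilityMeasure.limsup_measure_closed_le_of_tendsto h hK
  refine le_trans (limsup_le_limsup (Eventually.of_forall fun n => ?_)) (h1.trans ?_)
  · rw [ProbabilityMeasure.toMeasure_map,
      Measure.map_apply (measurable_evalRight E) hK.measurableSet]
    exact measure_mono fun φ hφ => subset_closure (mem_image_of_mem _ hφ)
  · rw [ProbabilityMeasure.toMeasure_map,
      Measure.map_apply (measurable_evalRight E) hK.measurableSet, onCadlag,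
      ProbabilityMeasure.toMeasure_map,
      Measure.map_apply ContFlow.continuous_toCadlag.measurable hmeas,
      Measure.map_apply ContFlow.continuous_toCadlag.measurable hF.measurableSet]
    -- a continuous flow whose image is adherent to `Z^E (F)` is adherent to `F`
    refine measure_mono fun φ hφ => ?_
    have h2 : (comap (evalRight E) (𝓝 (evalRight E φ.toCadlag)) ⊓ 𝓟 F).NeBot := by
      rw [← map_neBot_iff (evalRight E), Filter.push_pull', map_principal]
      exact mem_closure_iff_nhdsWithin_neBot.mp hφ
    exact hF.closure_subset (mem_closure_iff_nhdsWithin_neBot.mpr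
      (h2.mono (inf_le_inf_right _ (comap_evalRight_le_nhds hE φ))))

end WeakFlow

theorem theorem5p1 (E : ℕ → ℝ × ℝ)
    (hE : Set.range E = Set.range (fun q : ℚ × ℚ => ((q.1 : ℝ), (q.2 : ℝ)))) :
    ∃ hZ : Measurable (WeakFlow.evalRight E),
      ∀ (μs : ℕ → ProbabilityMeasure WeakFlow.CadlagFlow)
        (μ : ProbabilityMeasure WeakFlow.ContFlow),
        (∀ n, ∀ᵐ φ ∂(μs n : Measure WeakFlow.CadlagFlow),
          WeakFlow.evalLeft E φ = WeakFlow.evalRight E φ) →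
        (∀ᵐ φ ∂(μ : Measure WeakFlow.ContFlow),
          WeakFlow.evalLeft E φ.toCadlag = WeakFlow.evalRight E φ.toCadlag) →
        Tendsto (fun n => (μs n).map hZ.aemeasurable) atTop
          (𝓝 ((WeakFlow.onCadlag μ).map hZ.aemeasurable)) →
        Tendsto μs atTop (𝓝 (WeakFlow.onCadlag μ)) :=
  ⟨WeakFlow.measurable_evalRight E, fun μs μ _ _ h =>
    WeakFlow.tendsto_of_tendsto_map_evalRight hE μs μ h⟩
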